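/- Let $T\in\{1,2,\dots\}$, let $\Xi_1,\dots,\Xi_T$ be nonempty Polish spaces, and write $\Xi_{1:t}=\Xi_1\times\dots\times\Xi_t$, $\Xi=\Xi_{1:T}$, $x_{1:t}=(x_1,\dots,x_t)$, where $x_{1:0}=()$ is the empty tuple. Let $d$ be a metric on $\Xi$ such that $(\Xi,d)$ is Polish and its Borel $\sigma$-algebra is the product of the Borel $\sigma$-algebras of the $\Xi_t$. Let $P,\tilde P$ be Borel probability measures on $\Xi$ and let $r\in[1,\infty)$. Let $P_{t}(\cdot\mid x_{1:t-1})$ be the regular conditional distribution under $P$ of the coordinate $x_{t}$ given $x_{1:t-1}$, let $P(\cdot\mid x_{1:t})$ be that of the whole path given $x_{1:t}$, and similarly for $\tilde P$ (one fixed version of each is used). For probability measures $\mu,\nu$ on a space $X$ and $c\colon X\times X\to[0,\infty]$ put $$w_r(\mu,\nu;c)=\inf_{\rho}\Big(\iint c(u,v)^r\,\rho(\mathrm du,\mathrm dv)\Big)^{1/r},$$ the infimum being over all measures $\rho$ on $X\times X$ with marginals $\mu$ and $\nu$. Define the cost process backwards by $c_T=d$ and, for $t=T,\dots,1$ and $x_{1:t-1},y_{1:t-1}\in\Xi_{1:t-1}$,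 $$c_{t-1}(x_{1:t-1},y_{1:t-1})=w_r\Big(P_t(\cdot\mid x_{1:t-1}),\tilde P_t(\cdot\mid y_{1:t-1});\;(u,v)\mapsto c_t\big((x_{1:t-1},u),(y_{1:t-1},v)\big)\Big),$$ and let the nested distance be $\mathsf{nd}_r(P,\tilde P)=c_0\in[0,\infty]$. Say that a probability measure $\pi$ on $\Xi\times\Xi$ satisfies the conditional marginal constraints if for every $t\in\{0,\dots,T-1\}$ and all Borel sets $A,B\subseteq\Xi$, for $\pi$-almost all $(x,y)$, $$\pi(A\times\Xi\mid x_{1:t},y_{1:t})=P(A\mid x_{1:t})\quad\text{and}\quad \pi(\Xi\times B\mid x_{1:t},y_{1:t})=\tilde P(B\mid y_{1:t}).$$ Call a family of kernels $\pi_t(\cdot\mid x_{1:t-1},y_{1:t-1})$ from $\Xi_{1:t-1}\times\Xi_{1:t-1}$ to $\Xi_t\times\Xi_t$, $t=1,\dots,T$ (measurable in the conditioning variables), optimal if for all $t$, $x_{1:t-1}$, $y_{1:t-1}$ the measure $\pi_t(\cdot\mid x_{1:t-1},y_{1:t-1})$ has marginals $P_t(\cdot\mid x_{1:t-1})$ and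 $\tilde P_t(\cdot\mid y_{1:t-1})$ and attains the infimum that defines $c_{t-1}(x_{1:t-1},y_{1:t-1})$. Then $$\mathsf{nd}_r(P,\tilde P)=\inf_{\pi}\Big(\iint_{\Xi\times\Xi}d(x,y)^r\,\pi(\mathrm dx,\mathrm dy)\Big)^{1/r},$$ where the infimum is over all probability measures $\pi$ on $\Xi\times\Xi$ satisfying the conditional marginal constraints. Moreover, the infimum is attained by the glued optimal measure: optimal families of kernels exist, and for every optimal family $(\pi_t)_{t=1}^T$ the composed measure $$\pi(\mathrm dx,\mathrm dy)=\pi_T(\mathrm dx_T,\mathrm dy_T\mid x_{1:T-1},y_{1:T-1})\cdots\pi_2(\mathrm dx_2,\mathrm dy_2\mid x_1,y_1)\,\pi_1(\mathrm dx_1,\mathrm dy_1)$$ is a probability measure that satisfies the conditional marginal constraints and $\big(\iint d^r\,\mathrm d\pi\big)^{1/r}=\mathsf{nd}_r(P,\tilde P)$. -/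

import Mathlib

open MeasureTheory ProbabilityTheory

open scoped ENNReal

universe u

namespace NestedDistance

noncomputable section

/-- The space of histories up to stage `t`, i.e. the product of the first `t` state spaces.
The state spaces are numbered from `0`, so `Ξ i` is the space of stage `i + 1`; for a horizon `T`
only `Ξ 0, …, Ξ (T - 1)` play a role. `Hist Ξ 0` consists of the empty tuple only. -/
abbrev Hist (Ξ : ℕ → Type u) (t : ℕ) : Type u := (i : Fin t) → Ξ i

variable {Ξ : ℕ → Type u} {T : ℕ}

/-- The empty history. -/
def emptyHist (Ξ : ℕ → Type u) : Hist Ξ 0 := fun i => i.elim0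

/-- The projection of a full path onto its first `t` coordinates. -/
def pr (t : Fin T) (x : Hist Ξ T) : Hist Ξ t := fun i => x (Fin.castLE t.isLt.le i)

/-- The projection of a pair of full paths onto the pair of their first `t` coordinates. -/
def prPair (t : Fin T) (z : Hist Ξ T × Hist Ξ T) : Hist Ξ t × Hist Ξ t := (pr t z.1, pr t z.2)

/-- The history `x` of length `t`, continued by the state `u`. -/
def extend {t : ℕ} (x : Hist Ξ t) (u : Ξ t) : Hist Ξ (t + 1) :=
  Fin.snoc (α := fun i : Fin (t + 1) => Ξ i) x u

/-- `d` is a distance function on the measurable space `X` that makes it a Polish space and whose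
Borel sets are the measurable sets. -/
def IsPolishMetric {X : Type u} [MeasurableSpace X] (d : X → X → ℝ) : Prop :=
  ∃ m : MetricSpace X, (∀ x y, m.dist x y = d x y) ∧ PolishSpace X ∧ BorelSpace X

/-- `π` is a bivariate measure with marginals `μ` and `ν`. -/
def IsCoupling {X Y : Type u} [MeasurableSpace X] [MeasurableSpace Y]
    (μ : Measure X) (ν : Measure Y) (π : Measure (X × Y)) : Prop :=
  π.map Prod.fst = μ ∧ π.map Prod.snd = ν

/-- `(E_π c^r)^(1/r)`, with values in `[0, ∞]`. -/
def transportCost {X Y : Type u} [MeasurableSpace X] [MeasurableSpace Y]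
    (r : ℝ) (c : X → Y → ℝ≥0∞) (π : Measure (X × Y)) : ℝ≥0∞ :=
  (∫⁻ z, c z.1 z.2 ^ r ∂π) ^ (1 / r)

/-- The Wasserstein distance of order `r` with respect to the cost function `c`. -/
def wasserstein {X Y : Type u} [MeasurableSpace X] [MeasurableSpace Y]
    (r : ℝ) (μ : Measure X) (ν : Measure Y) (c : X → Y → ℝ≥0∞) : ℝ≥0∞ :=
  ⨅ (π : Measure (X × Y)) (_ : IsCoupling μ ν π), transportCost r c π

variable [∀ i, MeasurableSpace (Ξ i)]

section Kernels

variable [∀ i, StandardBorelSpace (Ξ i)] [∀ i, Nonempty (Ξ i)]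

/-- The regular conditional distribution under `P` of the next state given the first `t` ones. -/
def stageKernel (P : Measure (Hist Ξ T)) [IsFiniteMeasure P] (t : Fin T) :
    Kernel (Hist Ξ t) (Ξ t) :=
  condDistrib (fun x : Hist Ξ T => x t) (pr t) P

/-- The regular conditional distribution under `P` of the full path given its first `t`
coordinates. -/
def pathKernel (P : Measure (Hist Ξ T)) [IsFiniteMeasure P] (t : Fin T) :
    Kernel (Hist Ξ t) (Hist Ξ T) :=
  condDistrib (id : Hist Ξ T → Hist Ξ T) (pr t) P

/-- The regular conditional distribution under the bivariate measure `π` of the pair of full paths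
given the first `t` coordinates of both. -/
def pairKernel (π : Measure (Hist Ξ T × Hist Ξ T)) [IsFiniteMeasure π] (t : Fin T) :
    Kernel (Hist Ξ t × Hist Ξ t) (Hist Ξ T × Hist Ξ T) :=
  condDistrib (id : Hist Ξ T × Hist Ξ T → Hist Ξ T × Hist Ξ T) (prPair t) π

/-- The cost process `c_T, …, c_0`, defined backwards from the terminal cost `c`: `c_T = c`, and
`c_t` at a pair of histories of length `t` is the Wasserstein distance, with respect to `c_{t+1}`,
of the two conditional distributions of the next state. -/
def costProcess (r : ℝ) (P Q : Measure (Hist Ξ T)) [IsFiniteMeasure P] [IsFiniteMeasure Q]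
    (c : Hist Ξ T → Hist Ξ T → ℝ≥0∞) (t : Fin (T + 1)) : Hist Ξ t → Hist Ξ t → ℝ≥0∞ :=
  Fin.reverseInduction (motive := fun t : Fin (T + 1) => Hist Ξ t → Hist Ξ t → ℝ≥0∞)
    c
    (fun t cnext x y =>
      wasserstein r (stageKernel P t x) (stageKernel Q t y)
        (fun u v => cnext (extend x u) (extend y v)))
    t

/-- The nested distance of order `r` for the distance function `d` on the path space. -/
def nestedDist (r : ℝ) (d : Hist Ξ T → Hist Ξ T → ℝ) (P Q : Measure (Hist Ξ T))
    [IsFiniteMeasure P] [IsFiniteMeasure Q] : ℝ≥0∞ :=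
  costProcess r P Q (fun x y => ENNReal.ofReal (d x y)) 0 (emptyHist Ξ) (emptyHist Ξ)

/-- The conditional marginal constraints: for `t = 0, …, T - 1` and all events `A`, `B`,
`π (A × Ξ | x_{1:t}, y_{1:t}) = P (A | x_{1:t})` and
`π (Ξ × B | x_{1:t}, y_{1:t}) = Q (B | y_{1:t})`, almost surely. -/
def HasConditionalMarginals (P Q : Measure (Hist Ξ T)) [IsFiniteMeasure P] [IsFiniteMeasure Q]
    (π : Measure (Hist Ξ T × Hist Ξ T)) [IsFiniteMeasure π] : Prop :=
  ∀ t : Fin T,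
    (∀ A : Set (Hist Ξ T), MeasurableSet A → ∀ᵐ z ∂π,
      pairKernel π t (prPair t z) (A ×ˢ Set.univ) = pathKernel P t (pr t z.1) A) ∧
    (∀ B : Set (Hist Ξ T), MeasurableSet B → ∀ᵐ z ∂π,
      pairKernel π t (prPair t z) (Set.univ ×ˢ B) = pathKernel Q t (pr t z.2) B)

/-- The kernels `κ t` are optimal in the recursion that defines the cost process with terminal
cost `c`: at every pair of histories, `κ t` is a coupling of the two conditional distributions of
the next state that attains their Wasserstein distance. Being kernels, they depend measurably on
the pair of histories. -/
def AreOptimalKernels (r : ℝ) (P Q : Measure (Hist Ξ T)) [IsFiniteMeasure P] [IsFiniteMeasure Q]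
    (c : Hist Ξ T → Hist Ξ T → ℝ≥0∞)
    (κ : (t : Fin T) → Kernel (Hist Ξ t × Hist Ξ t) (Ξ t × Ξ t)) : Prop :=
  ∀ (t : Fin T) (x y : Hist Ξ t),
    IsCoupling (stageKernel P t x) (stageKernel Q t y) (κ t (x, y)) ∧
    transportCost r
        (fun u v => costProcess r P Q c t.succ (extend x u) (extend y v)) (κ t (x, y)) =
      wasserstein r (stageKernel P t x) (stageKernel Q t y)
        (fun u v => costProcess r P Q c t.succ (extend x u) (extend y v))

end Kernels

/-- The joint law of the first `t` stages of the two paths that is obtained by composing the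
kernels `κ 0, …, κ (t - 1)`. -/
def glueUpTo (κ : (t : Fin T) → Kernel (Hist Ξ t × Hist Ξ t) (Ξ t × Ξ t)) (t : Fin (T + 1)) :
    Measure (Hist Ξ t × Hist Ξ t) :=
  Fin.induction (motive := fun t : Fin (T + 1) => Measure (Hist Ξ t × Hist Ξ t))
    (Measure.dirac (emptyHist Ξ, emptyHist Ξ))
    (fun t μ => Measure.map (fun q : (Hist Ξ t × Hist Ξ t) × (Ξ t × Ξ t) =>
      ((extend q.1.1 q.2.1, extend q.1.2 q.2.2) : Hist Ξ (t + 1) × Hist Ξ (t + 1)))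
      (Measure.compProd μ (κ t)))
    t

/-- The bivariate measure on the full path space glued together from the kernels `κ`. -/
def glue (κ : (t : Fin T) → Kernel (Hist Ξ t × Hist Ξ t) (Ξ t × Ξ t)) :
    Measure (Hist Ξ T × Hist Ξ T) :=
  glueUpTo κ (Fin.last T)

end

end NestedDistance

/-! Let `π` satisfy the conditional marginal constraints. At `t = 0` they say that `π` has marginals
`P` and `Q`, and at each stage they say that the conditional law of the next pair of states couples
the two stage kernels, almost surely. This coupling competes in the infimum defining `c_t`, so the
`π`-integral of `c_t ^ r` is nondecreasing in `t`; comparing the two ends gives the lower bound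
(`HasConditionalMarginals.costProcess_zero_le`). For optimal kernels every step is an equality
(`AreOptimalKernels.transportCost_glue`).

The glued measure is admissible because it is causal: the first path moves by its own stage kernel
whatever the second path did, so given `x_{1:t}` the future of `x` is independent of `y_{1:t}`
(`lintegral_glue_prPair`). Exchanging the paths gives the other half.

What remains is the measurability of the cost process and of a choice of optimal couplings at all
histories. The stage kernels are only measurable in the history, so lower semicontinuity in a given
topology does not survive the recursion. The invariant used instead is that strict superlevel sets
are countable unions of measurable rectangles. Such a cost becomes lower semicontinuous once the
spaces are embedded in Cantor spaces. There couplings form compact sets, and the pairs of marginals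
with optimal cost at most `q` form a closed set, whose complement is a countable union of open
rectangles. Pulling back along the two kernels restores the invariant
(`RectSemicontinuous.exists_optimal_coupling`), and a minimizer is selected measurably by minimizing
further functions one after another. -/

open Set Filter Topology NNReal

namespace NestedDistance

/-! ### Measurable selection by iterated minimization -/

section Selection

variable {X Z : Type*} [MeasurableSpace X]

/-- A multifunction with nonempty closed values for which the set of points whose value meets
a given closed set is measurable. -/
structure IsMeasurableMultifunction [TopologicalSpace Z] (F : X → Set Z) : Prop where
  isClosed : ∀ x, IsClosed (F x)
  nonempty : ∀ x, (F x).Nonempty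
  measurableSet_hit : ∀ C, IsClosed C → MeasurableSet {x | (F x ∩ C).Nonempty}

/-- The points of `s` at which `J` attains its minimum over `s`. -/
def argminOn (J : Z → ℝ≥0∞) (s : Set Z) : Set Z := {z ∈ s | ∀ w ∈ s, J z ≤ J w}

lemma argminOn_nonempty [TopologicalSpace Z] [CompactSpace Z]
    {J : Z → ℝ≥0∞} (hJ : LowerSemicontinuous J) {s : Set Z}
    (hs : IsClosed s) (hne : s.Nonempty) : (argminOn J s).Nonempty := by
  obtain ⟨z, hz, hmin⟩ := LowerSemicontinuousOn.exists_isMinOn hne hs.isCompact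
    (hJ.lowerSemicontinuousOn s)
  exact ⟨z, hz, fun w hw => hmin hw⟩

/-- A minimizer over `s` lies in `C` exactly when the minimum over `s ∩ C` is no larger than that
over `s`, and rational levels detect this. Only countably many closed sets have to be hit by `s`,
which is what makes the argmin multifunction measurable. -/
lemma argminOn_inter_nonempty_iff [TopologicalSpace Z] [CompactSpace Z]
    {J : Z → ℝ≥0∞} (hJ : LowerSemicontinuous J) {s C : Set Z}
    (hs : IsClosed s) (hne : s.Nonempty) (hC : IsClosed C) :
    (argminOn J s ∩ C).Nonempty ↔ (s ∩ C).Nonempty ∧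
      ∀ q : ℚ, (s ∩ J ⁻¹' Iic (Real.toNNReal q : ℝ≥0∞)).Nonempty →
        (s ∩ (C ∩ J ⁻¹' Iic (Real.toNNReal q : ℝ≥0∞))).Nonempty := by
  constructor
  · rintro ⟨z, ⟨hz, hmin⟩, hzC⟩
    exact ⟨⟨z, hz, hzC⟩, fun q ⟨w, hw, hwq⟩ => ⟨z, hz, hzC, (hmin w hw).trans hwq⟩⟩
  · rintro ⟨hsC, hq⟩
    obtain ⟨z, hz, hmin⟩ := argminOn_nonempty hJ hs hne
    obtain ⟨w, ⟨hw, hwC⟩, hwmin⟩ := argminOn_nonempty hJ (hs.inter hC) hsC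
    refine ⟨w, ⟨hw, fun v hv => ?_⟩, hwC⟩
    refine le_trans ?_ (hmin v hv)
    by_contra! hlt
    obtain ⟨q, -, hzq, hqw⟩ := ENNReal.lt_iff_exists_rat_btwn.1 hlt
    obtain ⟨w', hw', hw'C, hw'q⟩ := hq q ⟨z, hz, hzq.le⟩
    exact absurd ((hwmin w' ⟨hw', hw'C⟩).trans hw'q) (not_le.2 hqw)

lemma IsMeasurableMultifunction.argminOn [TopologicalSpace Z] [CompactSpace Z]
    {F : X → Set Z} (hF : IsMeasurableMultifunction F)
    {J : Z → ℝ≥0∞} (hJ : LowerSemicontinuous J) :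
    IsMeasurableMultifunction fun x => argminOn J (F x) where
  isClosed x := by
    obtain ⟨z, hz, hmin⟩ := argminOn_nonempty hJ (hF.isClosed x) (hF.nonempty x)
    have : NestedDistance.argminOn J (F x) = F x ∩ J ⁻¹' Iic (J z) := by
      ext w
      exact ⟨fun h => ⟨h.1, h.2 z hz⟩, fun h => ⟨h.1, fun v hv => h.2.trans (hmin v hv)⟩⟩
    rw [this]
    exact (hF.isClosed x).inter (hJ.isClosed_preimage _)
  nonempty x := argminOn_nonempty hJ (hF.isClosed x) (hF.nonempty x)
  measurableSet_hit C hC := by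
    simp_rw [argminOn_inter_nonempty_iff hJ (hF.isClosed _) (hF.nonempty _) hC]
    have hq (q : ℚ) : IsClosed (J ⁻¹' Iic (Real.toNNReal q : ℝ≥0∞)) := hJ.isClosed_preimage _
    refine (hF.measurableSet_hit C hC).inter (MeasurableSet.congr (MeasurableSet.iInter fun q : ℚ =>
      (hF.measurableSet_hit _ (hq q)).compl.union (hF.measurableSet_hit _ (hC.inter (hq q)))) ?_)
    ext x
    simp only [mem_iInter, mem_union, mem_compl_iff, mem_ofPred_eq, imp_iff_not_or]
    rfl

/-- Iterated minimization along a sequence of functions. -/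
def iterArgminOn (f : ℕ → Z → ℝ≥0∞) (s : Set Z) : ℕ → Set Z
  | 0 => s
  | n + 1 => argminOn (f n) (iterArgminOn f s n)

lemma iterArgminOn_antitone (f : ℕ → Z → ℝ≥0∞) (s : Set Z) : Antitone (iterArgminOn f s) :=
  antitone_nat_of_succ_le fun _ => sep_subset _ _

lemma IsMeasurableMultifunction.iterArgminOn [TopologicalSpace Z] [CompactSpace Z]
    {F : X → Set Z} (hF : IsMeasurableMultifunction F)
    {f : ℕ → Z → ℝ≥0∞} (hf : ∀ n, LowerSemicontinuous (f n)) (n : ℕ) :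
    IsMeasurableMultifunction fun x => iterArgminOn f (F x) n := by
  induction n with
  | zero => exact hF
  | succ n ih => exact ih.argminOn (hf n)

/-- A measurable multifunction into a compact space has a measurable selection, if
a sequence of lower semicontinuous functions separates the points. -/
theorem IsMeasurableMultifunction.exists_selection [TopologicalSpace Z] [CompactSpace Z] {F : X → Set Z}
    (hF : IsMeasurableMultifunction F) {f : ℕ → Z → ℝ≥0∞} (hf : ∀ n, LowerSemicontinuous (f n))
    (hsep : ∀ z w, (∀ n, f n z = f n w) → z = w) :
    ∃ s : X → Z, (∀ x, s x ∈ F x) ∧ ∀ C, IsClosed C → MeasurableSet (s ⁻¹' C) := by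
  set G : ℕ → X → Set Z := fun n x => NestedDistance.iterArgminOn f (F x) n
  have hG (n : ℕ) : IsMeasurableMultifunction (G n) := hF.iterArgminOn hf n
  have hmono (x : X) : Antitone fun n => G n x := iterArgminOn_antitone f (F x)
  have hint (x : X) (C : Set Z) (hC : IsClosed C) (h : ∀ n, (G n x ∩ C).Nonempty) :
      (⋂ n, (G n x ∩ C)).Nonempty :=
    IsCompact.nonempty_iInter_of_sequence_nonempty_isCompact_isClosed _
      (fun n => inter_subset_inter_left _ (hmono x n.le_succ)) h
      (((hG 0).isClosed x).inter hC).isCompact fun n => ((hG n).isClosed x).inter hC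
  have huniv (x : X) : (⋂ n, (G n x ∩ univ)).Nonempty :=
    hint x univ isClosed_univ fun n => by simpa using (hG n).nonempty x
  choose s hs using huniv
  replace hs (x : X) (n : ℕ) : s x ∈ G n x := (mem_iInter.1 (hs x) n).1
  -- Both points lie in every `G (n + 1) x`, hence both minimize `f n` over `G n x`; all values
  -- agree and separation applies. The intersection is thus the single point `s x`, and it lies in
  -- `C` as soon as every `G n x` meets `C`.
  have huniq (x : X) (z : Z) (hz : ∀ n, z ∈ G n x) : z = s x :=
    hsep _ _ fun n => le_antisymm ((hz (n + 1)).2 _ (hs x n)) ((hs x (n + 1)).2 _ (hz n))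
  refine ⟨s, fun x => hs x 0, fun C hC => ?_⟩
  have : s ⁻¹' C = ⋂ n, {x | (G n x ∩ C).Nonempty} := by
    ext x
    simp only [mem_preimage, mem_iInter, mem_ofPred_eq]
    refine ⟨fun h n => ⟨s x, hs x n, h⟩, fun h => ?_⟩
    obtain ⟨z, hz⟩ := hint x C hC h
    rw [mem_iInter] at hz
    rw [← huniq x z fun n => (hz n).1]
    exact (hz 0).2
  rw [this]
  exact MeasurableSet.iInter fun n => (hG n).measurableSet_hit C hC

end Selection

/-! ### Rectangularly semicontinuous costs -/

section RectangularCosts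

variable {X Y X' Y' : Type*} [MeasurableSpace X] [MeasurableSpace Y] [MeasurableSpace X']
  [MeasurableSpace Y']

/-- A function on a product is rectangularly semicontinuous if its strict superlevel sets are
countable unions of measurable rectangles; equivalently, it is lower semicontinuous for suitable
second-countable topologies on the factors whose open sets are measurable. -/
def RectSemicontinuous (c : X × Y → ℝ≥0∞) : Prop :=
  ∀ q : ℝ≥0∞, ∃ (A : ℕ → Set X) (B : ℕ → Set Y), (∀ n, MeasurableSet (A n)) ∧
    (∀ n, MeasurableSet (B n)) ∧ {z | q < c z} = ⋃ n, A n ×ˢ B n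

lemma RectSemicontinuous.measurable {c : X × Y → ℝ≥0∞} (hc : RectSemicontinuous c) :
    Measurable c := by
  refine measurable_of_Ioi fun q => ?_
  obtain ⟨A, B, hA, hB, h⟩ := hc q
  change MeasurableSet {z | q < c z}
  rw [h]
  exact MeasurableSet.iUnion fun n => (hA n).prod (hB n)

lemma RectSemicontinuous.comp_map {c : X × Y → ℝ≥0∞} (hc : RectSemicontinuous c) {f : X' → X}
    {g : Y' → Y} (hf : Measurable f) (hg : Measurable g) :
    RectSemicontinuous fun z : X' × Y' => c (f z.1, g z.2) := by
  intro q
  obtain ⟨A, B, hA, hB, h⟩ := hc q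
  refine ⟨fun n => f ⁻¹' A n, fun n => g ⁻¹' B n, fun n => hf (hA n), fun n => hg (hB n), ?_⟩
  ext z
  have := Set.ext_iff.1 h (f z.1, g z.2)
  simpa using this

lemma RectSemicontinuous.rpow {c : X × Y → ℝ≥0∞} (hc : RectSemicontinuous c) {r : ℝ}
    (hr : 0 < r) : RectSemicontinuous fun z => c z ^ r := by
  intro q
  obtain ⟨A, B, hA, hB, h⟩ := hc (q ^ r⁻¹)
  refine ⟨A, B, hA, hB, h ▸ ?_⟩
  ext z
  simp [ENNReal.rpow_inv_lt_iff hr]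

/-- In a product of second-countable spaces, every open set is a countable union of open
rectangles. -/
lemma exists_iUnion_prod_of_isOpen {X Y : Type*} [TopologicalSpace X] [TopologicalSpace Y]
    [SecondCountableTopology X] [SecondCountableTopology Y]
    {U : Set (X × Y)} (hU : IsOpen U) :
    ∃ (A : ℕ → Set X) (B : ℕ → Set Y), (∀ n, IsOpen (A n)) ∧ (∀ n, IsOpen (B n)) ∧
      U = ⋃ n, A n ×ˢ B n := by
  set S : Set (Set X × Set Y) :=
    {p | p.1 ∈ TopologicalSpace.countableBasis X ∧ p.2 ∈ TopologicalSpace.countableBasis Y ∧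
      p.1 ×ˢ p.2 ⊆ U} with hS
  have hScount : S.Countable :=
    ((TopologicalSpace.countable_countableBasis X).prod
      (TopologicalSpace.countable_countableBasis Y)).mono fun _ hp => mem_prod.2 ⟨hp.1, hp.2.1⟩
  have hmem : ∀ z ∈ U, ∃ p ∈ S, z ∈ p.1 ×ˢ p.2 := by
    intro z hz
    obtain ⟨V, ⟨A, hA, B, hB, rfl⟩, hzV, hVU⟩ :=
      ((TopologicalSpace.isBasis_countableBasis X).prod
        (TopologicalSpace.isBasis_countableBasis Y)).exists_subset_of_mem_open hz hU
    exact ⟨(A, B), ⟨hA, hB, hVU⟩, hzV⟩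
  rcases S.eq_empty_or_nonempty with hemp | hne
  -- An empty family cannot be enumerated by `ℕ`; here `U` is empty.
  · refine ⟨fun _ => ∅, fun _ => ∅, by simp, by simp, ?_⟩
    ext z
    simp only [prod_empty, iUnion_empty, mem_empty_iff_false, iff_false]
    intro hz
    obtain ⟨p, hp, -⟩ := hmem z hz
    simp [hemp] at hp
  · obtain ⟨p, hp⟩ := hScount.exists_eq_range hne
    have hpS (n : ℕ) : p n ∈ S := hp ▸ mem_range_self n
    refine ⟨fun n => (p n).1, fun n => (p n).2,
      fun n => (TopologicalSpace.isBasis_countableBasis X).isOpen (hpS n).1,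
      fun n => (TopologicalSpace.isBasis_countableBasis Y).isOpen (hpS n).2.1, ?_⟩
    ext z
    refine ⟨fun hz => ?_, fun hz => ?_⟩
    · obtain ⟨q, hq, hzq⟩ := hmem z hz
      rw [hp] at hq
      obtain ⟨n, rfl⟩ := hq
      exact mem_iUnion.2 ⟨n, hzq⟩
    · obtain ⟨n, hn⟩ := mem_iUnion.1 hz
      exact (hpS n).2.2 hn

lemma LowerSemicontinuous.rectSemicontinuous {X Y : Type*} [TopologicalSpace X]
    [TopologicalSpace Y] [SecondCountableTopology X] [SecondCountableTopology Y]
    [MeasurableSpace X] [MeasurableSpace Y] [OpensMeasurableSpace X] [OpensMeasurableSpace Y]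
    {c : X × Y → ℝ≥0∞} (hc : LowerSemicontinuous c) : RectSemicontinuous c := by
  intro q
  obtain ⟨A, B, hA, hB, h⟩ := exists_iUnion_prod_of_isOpen (hc.isOpen_preimage q)
  exact ⟨A, B, fun n => (hA n).measurableSet, fun n => (hB n).measurableSet, h⟩

/-- The topology of `d` on the path space need not be the product topology. Only its Borel sets
matter, since the conclusion mentions nothing but the σ-algebra. -/
lemma IsPolishMetric.rectSemicontinuous {X : Type*} [MeasurableSpace X] {d : X → X → ℝ}
    (hd : IsPolishMetric d) : RectSemicontinuous fun z : X × X => ENNReal.ofReal (d z.1 z.2) := by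
  obtain ⟨m, hm, hpol, hbor⟩ := hd
  simp_rw [← hm]
  have : Continuous fun z : X × X => ENNReal.ofReal (m.dist z.1 z.2) :=
    ENNReal.continuous_ofReal.comp continuous_dist
  exact LowerSemicontinuous.rectSemicontinuous this.lowerSemicontinuous

/-- Countably many measurable sets of a standard Borel space become clopen in a suitable
measurable embedding into a Cantor space. -/
lemma exists_measurableEmbedding_cantor {X ι : Type*} [MeasurableSpace X] [StandardBorelSpace X]
    [Countable ι] (A : ι → Set X) (hA : ∀ k, MeasurableSet (A k)) :
    ∃ φ : X → (ℕ → Bool) × (ι → Bool), MeasurableEmbedding φ ∧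
      ∀ x k, (φ x).2 k = true ↔ x ∈ A k := by
  classical
  obtain ⟨e, he, hinj⟩ := MeasurableSpace.measurable_injection_nat_bool_of_countablySeparated X
  have hmeas : Measurable fun x k => decide (x ∈ A k) :=
    measurable_pi_lambda _ fun k => by
      refine measurable_to_bool ?_
      convert hA k using 1
      ext x
      simp
  refine ⟨fun x => (e x, fun k => decide (x ∈ A k)), ?_, by simp⟩
  -- Lusin–Souslin: a measurable injection out of a standard Borel space is an embedding. The first
  -- component `e` supplies injectivity, the second records membership in the `A k`.
  exact (he.prodMk hmeas).measurableEmbedding fun x y h => hinj (congrArg Prod.fst h)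

end RectangularCosts

/-! ### Optimal couplings on compact totally disconnected spaces -/

section CompactCoupling

set_option linter.unusedSectionVars false

variable {K L : Type*}
  [TopologicalSpace K] [CompactSpace K] [T2Space K] [SecondCountableTopology K]
  [TotallyDisconnectedSpace K] [MeasurableSpace K] [BorelSpace K]
  [TopologicalSpace L] [CompactSpace L] [T2Space L] [SecondCountableTopology L]
  [TotallyDisconnectedSpace L] [MeasurableSpace L] [BorelSpace L]

/-- A clopen set has empty frontier, so the portmanteau theorem applies at every `μ`. -/
lemma continuous_probabilityMeasure_apply_of_isClopen {K : Type*} [TopologicalSpace K]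
    [CompactSpace K] [T2Space K] [SecondCountableTopology K] [MeasurableSpace K] [BorelSpace K]
    {C : Set K} (hC : IsClopen C) :
    Continuous fun μ : ProbabilityMeasure K => (μ : Measure K) C := by
  rw [continuous_iff_continuousAt]
  exact fun μ => ProbabilityMeasure.tendsto_measure_of_null_frontier_of_tendsto' tendsto_id
    (by simp [hC.frontier_eq])

variable (K) in
lemma generateFrom_isClopen : ‹MeasurableSpace K› = .generateFrom {s : Set K | IsClopen s} :=
  (BorelSpace.measurable_eq (α := K)).trans isTopologicalBasis_isClopen.borel_eq_generateFrom

variable (K) in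
lemma isPiSystem_isClopen : IsPiSystem {s : Set K | IsClopen s} :=
  fun _ hs _ ht _ => IsClopen.inter hs ht

lemma probabilityMeasure_ext_of_isClopen {μ ν : ProbabilityMeasure K}
    (h : ∀ s, IsClopen s → (μ : Measure K) s = (ν : Measure K) s) : μ = ν := by
  refine Subtype.ext ?_
  have : IsProbabilityMeasure μ.1 := μ.2
  have : IsProbabilityMeasure ν.1 := ν.2
  exact ext_of_generate_finite _ (generateFrom_isClopen K) (isPiSystem_isClopen K) h (by simp)

/-- On a compact metrizable totally disconnected space, the Borel sets for the weak topology on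
the probability measures are those of the Giry monad. -/
instance borelSpace_probabilityMeasure : BorelSpace (ProbabilityMeasure K) := by
  refine ⟨le_antisymm ?_ ?_⟩
  · have h : @Measurable _ _ (borel (ProbabilityMeasure K)) _
        fun μ : ProbabilityMeasure K => (μ : Measure K) := by
      let _ : MeasurableSpace (ProbabilityMeasure K) := borel _
      have : BorelSpace (ProbabilityMeasure K) := ⟨rfl⟩
      refine Measurable.measure_of_isPiSystem_of_isProbabilityMeasure (generateFrom_isClopen K)
        (isPiSystem_isClopen K) fun s hs => ?_
      exact (continuous_probabilityMeasure_apply_of_isClopen hs).measurable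
    exact h.comap_le
  · have : Countable (TopologicalSpace.Clopens K) :=
      TopologicalSpace.Clopens.countable_iff_secondCountable.2 inferInstance
    let Φ : ProbabilityMeasure K → TopologicalSpace.Clopens K → ℝ≥0∞ :=
      fun μ C => (μ : Measure K) C
    have hΦ : Continuous Φ := continuous_pi fun C =>
      continuous_probabilityMeasure_apply_of_isClopen C.isClopen
    have hinj : Function.Injective Φ := fun μ ν h =>
      probabilityMeasure_ext_of_isClopen fun s hs => congrFun h ⟨s, hs⟩
    have hmeas : Measurable Φ := measurable_pi_lambda _ fun C =>
      (Measure.measurable_coe C.isClopen.isOpen.measurableSet).comp measurable_subtype_coe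
    rw [borel_eq_generateFrom_isClosed]
    refine MeasurableSpace.generateFrom_le fun F hF => ?_
    -- By compactness `Φ` is a closed embedding into a countable product, so the closed set `F` is
    -- the preimage of a closed set under a Giry-measurable map.
    rw [← hinj.preimage_image F]
    exact hmeas ((hΦ.isClosedEmbedding hinj).isClosedMap F hF).measurableSet

instance secondCountableTopology_probabilityMeasure {K : Type*} [TopologicalSpace K]
    [CompactSpace K] [T2Space K] [SecondCountableTopology K] [MeasurableSpace K] [BorelSpace K] :
    SecondCountableTopology (ProbabilityMeasure K) := by
  let _ := TopologicalSpace.metrizableSpaceMetric (ProbabilityMeasure K)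
  infer_instance

/-- The two marginals of a bivariate probability measure. -/
noncomputable def marginals (π : ProbabilityMeasure (K × L)) :
    ProbabilityMeasure K × ProbabilityMeasure L :=
  (π.map measurable_fst.aemeasurable, π.map measurable_snd.aemeasurable)

lemma continuous_marginals : Continuous (marginals (K := K) (L := L)) :=
  (ProbabilityMeasure.continuous_map continuous_fst).prodMk
    (ProbabilityMeasure.continuous_map continuous_snd)

lemma marginals_surjective : Function.Surjective (marginals (K := K) (L := L)) := by
  rintro ⟨μ, ν⟩
  refine ⟨μ.prod ν, Prod.ext (Subtype.ext ?_) (Subtype.ext ?_)⟩ <;> simp [marginals]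

/-- By monotone convergence the functional is a supremum of integrals of continuous functions, which
are bounded by compactness and so integrate weakly continuously. -/
lemma lowerSemicontinuous_lintegral_iSup {c : ℕ → K × L → ℝ≥0} (hc : ∀ n, Continuous (c n))
    (hmono : Monotone c) :
    LowerSemicontinuous fun π : ProbabilityMeasure (K × L) => ∫⁻ z, ⨆ n, (c n z : ℝ≥0∞) ∂π := by
  have (π : ProbabilityMeasure (K × L)) :
      ∫⁻ z, ⨆ n, (c n z : ℝ≥0∞) ∂π = ⨆ n, ∫⁻ z, (c n z : ℝ≥0∞) ∂π :=
    lintegral_iSup (fun n => (hc n).measurable.coe_nnreal_ennreal)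
      fun m n h z => ENNReal.coe_le_coe.2 (hmono h z)
  simp_rw [this]
  refine lowerSemicontinuous_iSup fun n => Continuous.lowerSemicontinuous ?_
  have := ENNReal.continuous_coe.comp (ProbabilityMeasure.continuous_testAgainstNN_eval
    (BoundedContinuousFunction.mkOfCompact ⟨c n, hc n⟩))
  refine this.congr fun π => ?_
  rw [Function.comp_apply, FiniteMeasure.testAgainstNN_coe_eq]
  rfl

/-- The couplings are a fibre of the continuous map `marginals`. A fibre meets a closed set `C`
exactly when its base point lies in `marginals '' C`, which is closed by compactness. With `C`
arbitrary this yields the measurable selection; with `C = {J ≤ q}` it shows that the optimal cost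
exceeds `q` on the preimage of an open set of pairs of marginals. -/
theorem exists_optimal_coupling_of_compact {X Y : Type*} [MeasurableSpace X] [MeasurableSpace Y]
    {g : X → ProbabilityMeasure K} {h : Y → ProbabilityMeasure L} (hg : Measurable g)
    (hh : Measurable h) {J : ProbabilityMeasure (K × L) → ℝ≥0∞} (hJ : LowerSemicontinuous J) :
    ∃ s : X × Y → ProbabilityMeasure (K × L), Measurable s ∧
      (∀ z, marginals (s z) = (g z.1, h z.2)) ∧
      (∀ z π, marginals π = (g z.1, h z.2) → J (s z) ≤ J π) ∧
      RectSemicontinuous fun z => J (s z) := by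
  have himage (C : Set (ProbabilityMeasure (K × L))) (hC : IsClosed C) :
      IsClosed (marginals '' C) := (hC.isCompact.image continuous_marginals).isClosed
  have hgh : Measurable fun z : X × Y => (g z.1, h z.2) :=
    (hg.comp measurable_fst).prodMk (hh.comp measurable_snd)
  have hF : IsMeasurableMultifunction
      fun z : X × Y => marginals ⁻¹' {(g z.1, h z.2)} :=
    { isClosed := fun z => isClosed_singleton.preimage continuous_marginals
      nonempty := fun z => marginals_surjective _
      measurableSet_hit := fun C hC => by
        convert hgh (himage C hC).measurableSet using 1
        ext z
        constructor
        · rintro ⟨π, hπ, hπC⟩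
          exact ⟨π, hπC, hπ⟩
        · rintro ⟨π, hπC, hπ⟩
          exact ⟨π, hπ, hπC⟩ }
  have : Countable (TopologicalSpace.Clopens (K × L)) :=
    TopologicalSpace.Clopens.countable_iff_secondCountable.2 inferInstance
  obtain ⟨e, he⟩ := exists_surjective_nat (TopologicalSpace.Clopens (K × L))
  -- First `J` is minimized, then the masses of the countably many clopen sets, which separate
  -- measures.
  obtain ⟨s, hs, hsmeas⟩ := (hF.argminOn hJ).exists_selection
    (f := fun n π => (π : Measure (K × L)) (e n))
    (fun n => (continuous_probabilityMeasure_apply_of_isClopen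
      (e n).isClopen).lowerSemicontinuous)
    (fun π ρ hπρ => probabilityMeasure_ext_of_isClopen fun S hS => by
      obtain ⟨n, hn⟩ := he ⟨S, hS⟩
      simpa [hn] using hπρ n)
  refine ⟨s, measurable_of_isClosed hsmeas, fun z => (hs z).1, fun z π hπ => (hs z).2 π hπ,
    fun q => ?_⟩
  obtain ⟨A, B, hA, hB, hAB⟩ := exists_iUnion_prod_of_isOpen
    (himage _ (hJ.isClosed_preimage q)).isOpen_compl
  refine ⟨fun n => g ⁻¹' A n, fun n => h ⁻¹' B n, fun n => hg (hA n).measurableSet,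
    fun n => hh (hB n).measurableSet, ?_⟩
  ext z
  have hz := Set.ext_iff.1 hAB (g z.1, h z.2)
  simp only [mem_iUnion, mem_prod, mem_preimage] at hz ⊢
  rw [← hz]
  constructor
  · rintro hq ⟨π, hπ, hπz⟩
    exact absurd (((hs z).2 π hπz).trans hπ) (not_le.2 hq)
  · intro hz
    by_contra hq
    exact hz ⟨s z, show J (s z) ≤ q from not_lt.1 hq, (hs z).1⟩

end CompactCoupling

/-! ### Measurable optimal couplings on standard Borel spaces -/

section OptimalCoupling

/-- A rectangularly semicontinuous function is the pullback of an increasing limit of continuous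
functions under measurable embeddings of the factors into a Cantor space. -/
lemma RectSemicontinuous.exists_cantor_model {S T : Type*} [MeasurableSpace S]
    [StandardBorelSpace S] [MeasurableSpace T] [StandardBorelSpace T] {c : S × T → ℝ≥0∞}
    (hc : RectSemicontinuous c) :
    ∃ (φ : S → (ℕ → Bool) × (ℚ × ℕ → Bool)) (ψ : T → (ℕ → Bool) × (ℚ × ℕ → Bool))
      (f : ℕ → ((ℕ → Bool) × (ℚ × ℕ → Bool)) × ((ℕ → Bool) × (ℚ × ℕ → Bool)) → ℝ≥0),
      MeasurableEmbedding φ ∧ MeasurableEmbedding ψ ∧ (∀ n, Continuous (f n)) ∧ Monotone f ∧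
      ∀ x y, c (x, y) = ⨆ n, (f n (φ x, ψ y) : ℝ≥0∞) := by
  choose A B hA hB hAB using fun q : ℚ => hc (Real.toNNReal q)
  obtain ⟨φ, hφ, hφA⟩ := exists_measurableEmbedding_cantor (fun k : ℚ × ℕ => A k.1 k.2)
    fun k => hA k.1 k.2
  obtain ⟨ψ, hψ, hψB⟩ := exists_measurableEmbedding_cantor (fun k : ℚ × ℕ => B k.1 k.2)
    fun k => hB k.1 k.2
  obtain ⟨e, he⟩ := exists_surjective_nat (ℚ × ℕ)
  -- On the rectangle numbered `(q, n)` the cost exceeds `q`, so `q` times its indicator lies below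
  -- `c`, and these functions have supremum `c`. In the Cantor model the rectangle is clopen, so
  -- they are continuous there; finite maxima make the sequence increasing.
  let f₀ (k : ℚ × ℕ) (z : ((ℕ → Bool) × (ℚ × ℕ → Bool)) × ((ℕ → Bool) × (ℚ × ℕ → Bool))) :
    ℝ≥0 := if z.1.2 k && z.2.2 k then Real.toNNReal k.1 else 0
  have hf₀ (k : ℚ × ℕ) : Continuous (f₀ k) :=
    Continuous.comp (g := fun p : Bool × Bool => if p.1 && p.2 then Real.toNNReal k.1 else 0)
      (f := fun z : ((ℕ → Bool) × (ℚ × ℕ → Bool)) × ((ℕ → Bool) × (ℚ × ℕ → Bool)) =>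
        (z.1.2 k, z.2.2 k)) continuous_of_discreteTopology (by fun_prop)
  refine ⟨φ, ψ, fun n z => (Finset.range n).sup fun i => f₀ (e i) z, hφ, hψ,
    fun n => Continuous.finset_sup_apply fun i _ => hf₀ (e i),
    fun m n hmn z => Finset.sup_mono (Finset.range_mono hmn), fun x y => le_antisymm ?_ ?_⟩
  · refine le_of_forall_lt fun b hb => ?_
    obtain ⟨q, -, hbq, hqc⟩ := ENNReal.lt_iff_exists_rat_btwn.1 hb
    have hmem : (x, y) ∈ ⋃ n, A q n ×ˢ B q n := hAB q ▸ hqc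
    obtain ⟨n, hn⟩ := mem_iUnion.1 hmem
    obtain ⟨i, hi⟩ := he (q, n)
    refine hbq.trans_le (le_iSup_of_le (i + 1) (ENNReal.coe_le_coe.2 ?_))
    have hval : f₀ (e i) (φ x, ψ y) = Real.toNNReal q := by
      simp only [f₀, hi]
      rw [if_pos]
      rw [(hφA x (q, n)).2 hn.1, (hψB y (q, n)).2 hn.2]
      rfl
    rw [← hval]
    exact Finset.le_sup (f := fun i => f₀ (e i) (φ x, ψ y)) (Finset.self_mem_range_succ i)
  · refine iSup_le fun n => ?_
    rw [ENNReal.coe_finset_sup]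
    refine Finset.sup_le fun i _ => ?_
    simp only [f₀]
    split_ifs with h
    · rw [Bool.and_eq_true, hφA, hψB] at h
      have hmem : (x, y) ∈ {z | (Real.toNNReal (e i).1 : ℝ≥0∞) < c z} := by
        rw [hAB]
        exact mem_iUnion.2 ⟨(e i).2, h⟩
      exact le_of_lt hmem
    · simp

lemma IsCoupling.isProbabilityMeasure {S T : Type u} [MeasurableSpace S] [MeasurableSpace T]
    {μ : Measure S} [IsProbabilityMeasure μ] {ν : Measure T} {ρ : Measure (S × T)}
    (h : IsCoupling μ ν ρ) : IsProbabilityMeasure ρ := by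
  constructor
  rw [← measure_univ (μ := μ), ← h.1, Measure.map_apply measurable_fst .univ, preimage_univ]

variable {X Y : Type*} [MeasurableSpace X] [MeasurableSpace Y] {S T : Type u} [MeasurableSpace S]
  [StandardBorelSpace S] [MeasurableSpace T] [StandardBorelSpace T]

/-- For a rectangularly semicontinuous cost, optimal couplings of two kernels exist, they can be
chosen measurably, and the optimal cost is again rectangularly semicontinuous. -/
theorem RectSemicontinuous.exists_optimal_coupling {c : S × T → ℝ≥0∞}
    (hc : RectSemicontinuous c) (μ : Kernel X S) [IsMarkovKernel μ] (ν : Kernel Y T)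
    [IsMarkovKernel ν] :
    ∃ κ : Kernel (X × Y) (S × T), (∀ z, IsCoupling (μ z.1) (ν z.2) (κ z)) ∧
      (∀ z ρ, IsCoupling (μ z.1) (ν z.2) ρ → ∫⁻ w, c w ∂κ z ≤ ∫⁻ w, c w ∂ρ) ∧
      RectSemicontinuous fun z => ∫⁻ w, c w ∂κ z := by
  obtain ⟨φ, ψ, f, hφ, hψ, hf, hmono, hcf⟩ := hc.exists_cantor_model
  have hprob (x : X) : IsProbabilityMeasure ((μ x).map φ) :=
    Measure.isProbabilityMeasure_map hφ.measurable.aemeasurable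
  have hprob' (y : Y) : IsProbabilityMeasure ((ν y).map ψ) :=
    Measure.isProbabilityMeasure_map hψ.measurable.aemeasurable
  obtain ⟨s, hs, hsm, hopt, hrect⟩ := exists_optimal_coupling_of_compact
    (g := fun x => (⟨(μ x).map φ, hprob x⟩ : ProbabilityMeasure _))
    (h := fun y => (⟨(ν y).map ψ, hprob' y⟩ : ProbabilityMeasure _))
    (((Measure.measurable_map φ hφ.measurable).comp μ.measurable).subtype_mk)
    (((Measure.measurable_map ψ hψ.measurable).comp ν.measurable).subtype_mk)
    (lowerSemicontinuous_lintegral_iSup hf hmono)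
  have hs₁ (z : X × Y) : (s z).toMeasure.map Prod.fst = (μ z.1).map φ :=
    congrArg (fun p => p.1.1) (hsm z)
  have hs₂ (z : X × Y) : (s z).toMeasure.map Prod.snd = (ν z.2).map ψ :=
    congrArg (fun p => p.2.1) (hsm z)
  have hΦ : MeasurableEmbedding (Prod.map φ ψ) := hφ.prodMap hψ
  -- The marginals of `s z` live on the ranges of `φ` and `ψ`, so `s z` lives on the range of the
  -- product embedding and `comap` loses no mass.
  have hrange (z : X × Y) : ∀ᵐ w ∂(s z).toMeasure, w ∈ range (Prod.map φ ψ) := by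
    have h₁ : ∀ᵐ w ∂(s z).toMeasure, w.1 ∈ range φ :=
      ae_of_ae_map measurable_fst.aemeasurable <| by
        rw [hs₁]
        exact ae_map_mem_range _ hφ.measurableSet_range _
    have h₂ : ∀ᵐ w ∂(s z).toMeasure, w.2 ∈ range ψ :=
      ae_of_ae_map measurable_snd.aemeasurable <| by
        rw [hs₂]
        exact ae_map_mem_range _ hψ.measurableSet_range _
    filter_upwards [h₁, h₂] with w hw₁ hw₂
    rw [range_prodMap]
    exact ⟨hw₁, hw₂⟩
  let κ : Kernel (X × Y) (S × T) :=
    { toFun := fun z => (s z).toMeasure.comap (Prod.map φ ψ)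
      measurable' := by
        refine Measure.measurable_of_measurable_coe _ fun A hA => ?_
        simp_rw [hΦ.comap_apply]
        exact (Measure.measurable_coe (hΦ.measurableSet_image.2 hA)).comp
          (measurable_subtype_coe.comp hs) }
  have hκ (z : X × Y) : (κ z).map (Prod.map φ ψ) = (s z).toMeasure := by
    change ((s z).toMeasure.comap (Prod.map φ ψ)).map (Prod.map φ ψ) = _
    rw [hΦ.map_comap, Measure.restrict_eq_self_of_ae_mem (hrange z)]
  have hcost (ρ : Measure (S × T)) : ∫⁻ w, c w ∂ρ =
      ∫⁻ w, ⨆ n, (f n w : ℝ≥0∞) ∂(ρ.map (Prod.map φ ψ)) := by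
    rw [lintegral_map (Measurable.iSup fun n => (hf n).measurable.coe_nnreal_ennreal)
      hΦ.measurable]
    exact lintegral_congr fun w => hcf w.1 w.2
  refine ⟨κ, fun z => ⟨?_, ?_⟩, fun z ρ hρ => ?_, ?_⟩
  · rw [← hφ.comap_map (μ := (κ z).map Prod.fst), ← hφ.comap_map (μ := μ z.1), ← hs₁, ← hκ,
      Measure.map_map hφ.measurable measurable_fst, Measure.map_map measurable_fst hΦ.measurable]
    rfl
  · rw [← hψ.comap_map (μ := (κ z).map Prod.snd), ← hψ.comap_map (μ := ν z.2), ← hs₂, ← hκ,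
      Measure.map_map hψ.measurable measurable_snd, Measure.map_map measurable_snd hΦ.measurable]
    rfl
  · have := hρ.isProbabilityMeasure
    have hmap : IsProbabilityMeasure (ρ.map (Prod.map φ ψ)) :=
      Measure.isProbabilityMeasure_map hΦ.measurable.aemeasurable
    rw [hcost, hcost, hκ]
    refine hopt z ⟨ρ.map (Prod.map φ ψ), hmap⟩ (Prod.ext (Subtype.ext ?_) (Subtype.ext ?_))
    · change (ρ.map (Prod.map φ ψ)).map Prod.fst = (μ z.1).map φ
      rw [← hρ.1, Measure.map_map hφ.measurable measurable_fst,
        Measure.map_map measurable_fst hΦ.measurable]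
      rfl
    · change (ρ.map (Prod.map φ ψ)).map Prod.snd = (ν z.2).map ψ
      rw [← hρ.2, Measure.map_map hψ.measurable measurable_snd,
        Measure.map_map measurable_snd hΦ.measurable]
      rfl
  · simp_rw [hcost, hκ]
    exact hrect

lemma ae_map_prodMk_fst_eq {H S : Type*} [MeasurableSpace H] [MeasurableSingletonClass H]
    [MeasurableSpace S] (μ : Measure S) (a : H) : ∀ᵐ p ∂μ.map (Prod.mk a), p.1 = a :=
  (ae_map_iff (p := fun p : H × S => p.1 = a) measurable_prodMk_left.aemeasurable
    (measurable_fst (measurableSet_singleton a))).2 (ae_of_all _ fun _ => rfl)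

/-- The version of `RectSemicontinuous.exists_optimal_coupling` for the Wasserstein distance with
a cost that also depends on the conditioning variables. -/
theorem RectSemicontinuous.exists_optimal_kernel {H G S T : Type u}
    [MeasurableSpace H] [StandardBorelSpace H] [MeasurableSpace G] [StandardBorelSpace G]
    [MeasurableSpace S] [StandardBorelSpace S] [MeasurableSpace T] [StandardBorelSpace T]
    {c : (H × S) × (G × T) → ℝ≥0∞} (hc : RectSemicontinuous c) {r : ℝ} (hr : 0 < r)
    (μ : Kernel H S) [IsMarkovKernel μ] (ν : Kernel G T) [IsMarkovKernel ν] :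
    ∃ κ : Kernel (H × G) (S × T),
      (∀ z, IsCoupling (μ z.1) (ν z.2) (κ z) ∧
        transportCost r (fun u v => c ((z.1, u), (z.2, v))) (κ z) =
          wasserstein r (μ z.1) (ν z.2) fun u v => c ((z.1, u), (z.2, v))) ∧
      RectSemicontinuous fun z : H × G =>
        wasserstein r (μ z.1) (ν z.2) fun u v => c ((z.1, u), (z.2, v)) := by
  -- The histories are carried along as Dirac components: `μ x` becomes the product of `δ_x` and `μ
  -- x`. The cost then no longer depends on a parameter, and the couplings are the old ones with `x`
  -- and `y` attached.
  obtain ⟨κ, hκ, hopt, hrect⟩ := (hc.rpow hr).exists_optimal_coupling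
    (Kernel.id ×ₖ μ) (Kernel.id ×ₖ ν)
  simp_rw [Kernel.prod_apply, Kernel.id_apply, Measure.dirac_prod] at hκ hopt
  have hmeas : Measurable fun w : (H × S) × (G × T) => (w.1.2, w.2.2) := by fun_prop
  have hcm : Measurable c := hc.measurable
  have hcoup (z : H × G) : IsCoupling (μ z.1) (ν z.2) (κ.map (fun w => (w.1.2, w.2.2)) z) := by
    rw [Kernel.map_apply _ hmeas]
    constructor
    · rw [Measure.map_map measurable_fst hmeas]
      have := congrArg (Measure.map Prod.snd) (hκ z).1
      rw [Measure.map_map measurable_snd measurable_fst,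
        Measure.map_map measurable_snd measurable_prodMk_left] at this
      exact this.trans Measure.map_id
    · rw [Measure.map_map measurable_snd hmeas]
      have := congrArg (Measure.map Prod.snd) (hκ z).2
      rw [Measure.map_map measurable_snd measurable_snd,
        Measure.map_map measurable_snd measurable_prodMk_left] at this
      exact this.trans Measure.map_id
  have hcost (z : H × G) :
      transportCost r (fun u v => c ((z.1, u), (z.2, v))) (κ.map (fun w => (w.1.2, w.2.2)) z) =
        (∫⁻ w, c w ^ r ∂κ z) ^ (1 / r) := by
    have h₁ : ∀ᵐ w ∂κ z, w.1.1 = z.1 :=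
      ae_of_ae_map (p := fun p : H × S => p.1 = z.1) measurable_fst.aemeasurable
        ((hκ z).1 ▸ ae_map_prodMk_fst_eq _ _)
    have h₂ : ∀ᵐ w ∂κ z, w.2.1 = z.2 :=
      ae_of_ae_map (p := fun p : G × T => p.1 = z.2) measurable_snd.aemeasurable
        ((hκ z).2 ▸ ae_map_prodMk_fst_eq _ _)
    rw [transportCost, Kernel.map_apply _ hmeas, lintegral_map (by fun_prop) hmeas]
    congr 1
    refine lintegral_congr_ae ?_
    filter_upwards [h₁, h₂] with w hw₁ hw₂
    rw [← hw₁, ← hw₂]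
  have hwas (z : H × G) :
      wasserstein r (μ z.1) (ν z.2) (fun u v => c ((z.1, u), (z.2, v))) =
        (∫⁻ w, c w ^ r ∂κ z) ^ (1 / r) := by
    refine le_antisymm ((iInf₂_le _ (hcoup z)).trans (hcost z).le) (le_iInf₂ fun ρ hρ => ?_)
    refine ENNReal.rpow_le_rpow ?_ (by positivity)
    have hm : Measurable fun w : S × T => ((z.1, w.1), (z.2, w.2)) := by fun_prop
    refine (hopt z (ρ.map fun w => ((z.1, w.1), (z.2, w.2))) ⟨?_, ?_⟩).trans ?_
    · rw [← hρ.1, Measure.map_map measurable_fst hm,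
        Measure.map_map measurable_prodMk_left measurable_fst]
      rfl
    · rw [← hρ.2, Measure.map_map measurable_snd hm,
        Measure.map_map measurable_prodMk_left measurable_snd]
      rfl
    · rw [lintegral_map (by fun_prop) hm]
  refine ⟨κ.map fun w => (w.1.2, w.2.2), fun z => ⟨hcoup z, (hcost z).trans (hwas z).symm⟩, ?_⟩
  simp_rw [hwas]
  exact hrect.rpow (by positivity)

end OptimalCoupling

/-! ### Truncating and extending histories -/

section Histories

variable {Ξ : ℕ → Type u} {T s t : ℕ}

/-- The projection of a history onto its first `s` coordinates. -/
def trunc (h : s ≤ t) (x : Hist Ξ t) : Hist Ξ s := fun i => x (Fin.castLE h i)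

@[simp] lemma extend_castSucc (x : Hist Ξ t) (u : Ξ t) (i : Fin t) :
    extend x u i.castSucc = x i :=
  Fin.snoc_castSucc (α := fun i : Fin (t + 1) => Ξ i) u x i

@[simp] lemma extend_last (x : Hist Ξ t) (u : Ξ t) : extend x u (Fin.last t) = u :=
  Fin.snoc_last (α := fun i : Fin (t + 1) => Ξ i) u x

lemma trunc_extend (h : s ≤ t) (x : Hist Ξ t) (u : Ξ t) :
    trunc (h.trans t.le_succ) (extend x u) = trunc h x :=
  funext fun i => extend_castSucc x u (Fin.castLE h i)

lemma extend_trunc (h : t < s) (x : Hist Ξ s) :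
    extend (trunc h.le x) (x ⟨t, h⟩) = trunc (Nat.succ_le_of_lt h) x := by
  funext i
  refine Fin.lastCases ?_ (fun i => ?_) i
  · exact extend_last _ _
  · exact extend_castSucc _ _ i

instance : Subsingleton (Hist Ξ 0) := ⟨fun _ _ => funext fun i => i.elim0⟩

variable [∀ i, MeasurableSpace (Ξ i)]

@[fun_prop]
lemma measurable_trunc (h : s ≤ t) : Measurable (trunc h : Hist Ξ t → Hist Ξ s) :=
  measurable_pi_lambda _ fun _ => measurable_pi_apply _

@[fun_prop]
lemma measurable_pr (t : Fin T) : Measurable (pr t : Hist Ξ T → Hist Ξ t) :=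
  measurable_trunc _

@[fun_prop]
lemma measurable_prPair (t : Fin T) :
    Measurable (prPair t : Hist Ξ T × Hist Ξ T → Hist Ξ t × Hist Ξ t) :=
  ((measurable_pr t).comp measurable_fst).prodMk ((measurable_pr t).comp measurable_snd)

lemma measurable_extend : Measurable fun p : Hist Ξ t × Ξ t => extend p.1 p.2 := by
  refine measurable_pi_lambda _ fun i => ?_
  refine Fin.lastCases ?_ (fun i => ?_) i
  · simpa using! measurable_snd
  · simpa using! (measurable_pi_apply i).comp measurable_fst

@[fun_prop]
lemma Measurable.extend {α : Type*} [MeasurableSpace α] {f : α → Hist Ξ t} {g : α → Ξ t}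
    (hf : Measurable f) (hg : Measurable g) : Measurable fun a => extend (f a) (g a) :=
  measurable_extend.comp (hf.prodMk hg)

lemma measurable_extend_pair : Measurable fun q : (Hist Ξ t × Hist Ξ t) × (Ξ t × Ξ t) =>
    ((extend q.1.1 q.2.1, extend q.1.2 q.2.2) : Hist Ξ (t + 1) × Hist Ξ (t + 1)) := by
  fun_prop

end Histories

/-! ### Regularity of the cost process -/

section CostProcess

variable {Ξ : ℕ → Type u} {T : ℕ} [∀ i, MeasurableSpace (Ξ i)] [∀ i, StandardBorelSpace (Ξ i)]
  [∀ i, Nonempty (Ξ i)] {r : ℝ} {P Q : Measure (Hist Ξ T)} [IsFiniteMeasure P]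
  [IsFiniteMeasure Q] {c : Hist Ξ T → Hist Ξ T → ℝ≥0∞}

instance (t : Fin T) : IsMarkovKernel (stageKernel P t) := by
  unfold stageKernel; infer_instance

instance (t : Fin T) : IsMarkovKernel (pathKernel P t) := by
  unfold pathKernel; infer_instance

lemma costProcess_last : costProcess r P Q c (Fin.last T) = c :=
  Fin.reverseInduction_last ..

lemma costProcess_castSucc (t : Fin T) (x y : Hist Ξ t) :
    costProcess r P Q c t.castSucc x y = wasserstein r (stageKernel P t x) (stageKernel Q t y)
      fun u v => costProcess r P Q c t.succ (extend x u) (extend y v) := by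
  unfold costProcess
  rw [Fin.reverseInduction_castSucc]

/-- Backward induction: extending histories is measurable, and optimal transport between measurable
kernels preserves the rectangular class. -/
lemma RectSemicontinuous.costProcess (hr : 0 < r)
    (hc : RectSemicontinuous fun z : Hist Ξ T × Hist Ξ T => c z.1 z.2) (t : Fin (T + 1)) :
    RectSemicontinuous fun z : Hist Ξ t × Hist Ξ t =>
      NestedDistance.costProcess r P Q c t z.1 z.2 := by
  induction t using Fin.reverseInduction with
  | last => rw [costProcess_last]; exact hc
  | cast t ih =>
    obtain ⟨-, -, h⟩ := (ih.comp_map measurable_extend measurable_extend).exists_optimal_kernel hr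
      (stageKernel P t) (stageKernel Q t)
    have hfun : (fun z : Hist Ξ t × Hist Ξ t =>
        NestedDistance.costProcess r P Q c t.castSucc z.1 z.2) = _ :=
      funext fun z => costProcess_castSucc t z.1 z.2
    exact hfun ▸ h

lemma exists_areOptimalKernels (hr : 0 < r)
    (hc : RectSemicontinuous fun z : Hist Ξ T × Hist Ξ T => c z.1 z.2) :
    ∃ κ : (t : Fin T) → Kernel (Hist Ξ t × Hist Ξ t) (Ξ t × Ξ t),
      AreOptimalKernels r P Q c κ := by
  have h (t : Fin T) := ((hc.costProcess (P := P) (Q := Q) hr t.succ).comp_map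
    measurable_extend measurable_extend).exists_optimal_kernel hr (stageKernel P t)
      (stageKernel Q t)
  choose κ hκ _ using h
  exact ⟨κ, fun t x y => hκ t (x, y)⟩

end CostProcess

/-! ### Conditional marginal constraints and the lower bound -/

section ConditionalMarginals

/-- A kernel is a version of the conditional distribution of `f` given `X`, in the sense that for
each event the conditional probabilities agree almost surely, if and only if it disintegrates the
joint law. -/
lemma forall_ae_condDistrib_preimage_eq_iff {Ω H E : Type*} [MeasurableSpace Ω]
    [StandardBorelSpace Ω] [Nonempty Ω] [MeasurableSpace H] [MeasurableSpace E]
    [StandardBorelSpace E] [Nonempty E] {π : Measure Ω} [IsFiniteMeasure π] {X : Ω → H}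
    (hX : Measurable X) {f : Ω → E} (hf : Measurable f) {η : Kernel H E} [IsFiniteKernel η] :
    (∀ A, MeasurableSet A → ∀ᵐ ω ∂π, condDistrib id X π (X ω) (f ⁻¹' A) = η (X ω) A) ↔
      π.map (fun ω => (X ω, f ω)) = π.map X ⊗ₘ η := by
  have hcond : condDistrib f X π =ᵐ[π.map X] (condDistrib id X π).map f :=
    condDistrib_comp X aemeasurable_id hf
  constructor
  · intro h
    rw [← compProd_map_condDistrib hf.aemeasurable, Measure.compProd_congr hcond]
    -- Testing on rectangles treats one event `A` at a time, so the exceptional null sets may depend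
    -- on `A`.
    refine Measure.ext_prod fun {s A} hs hA => ?_
    rw [Measure.compProd_apply_prod hs hA, Measure.compProd_apply_prod hs hA]
    refine setLIntegral_congr_fun_ae hs ?_
    have hae : ∀ᵐ x ∂π.map X, (condDistrib id X π).map f x A = η x A := by
      rw [ae_map_iff hX.aemeasurable
        (measurableSet_eq_fun (Kernel.measurable_coe _ hA) (Kernel.measurable_coe _ hA))]
      filter_upwards [h A hA] with ω hω
      rw [Kernel.map_apply' _ hf _ hA, hω]
    exact hae.mono fun x hx _ => hx
  · intro h A hA
    have := ae_of_ae_map hX.aemeasurable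
      (hcond.symm.trans (condDistrib_ae_eq_of_measure_eq_compProd X hf.aemeasurable h))
    filter_upwards [this] with ω hω
    rw [← hω, Kernel.map_apply' _ hf _ hA]

/-- Conditioning on a variable with a single possible value changes nothing; this serves the stage
`t = 0`. -/
lemma map_eq_of_subsingleton {Ω H E : Type*} [MeasurableSpace Ω] [MeasurableSpace H]
    [Subsingleton H] [MeasurableSpace E] {μ : Measure Ω} [IsProbabilityMeasure μ] {X : Ω → H}
    (hX : Measurable X) {f : Ω → E} {η : Kernel H E} [IsMarkovKernel η]
    (h : μ.map (fun ω => (X ω, f ω)) = μ.map X ⊗ₘ η) (e : H) : μ.map f = η e := by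
  have h₀ := congrArg Measure.snd h
  have hXe : X = fun _ => e := funext fun _ => Subsingleton.elim _ _
  rw [Measure.snd_map_prodMk hX, Measure.snd_compProd] at h₀
  rw [h₀, hXe, Measure.map_const, measure_univ, one_smul, Measure.dirac_bind (Kernel.measurable _)]

variable {Ξ : ℕ → Type u} {T : ℕ} [∀ i, MeasurableSpace (Ξ i)] [∀ i, StandardBorelSpace (Ξ i)]
  [∀ i, Nonempty (Ξ i)] {P Q : Measure (Hist Ξ T)} [IsProbabilityMeasure P]
  [IsProbabilityMeasure Q] {π : Measure (Hist Ξ T × Hist Ξ T)} [IsProbabilityMeasure π]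

/-- Identities of joint laws replace event-wise almost sure identities: they can be checked by
integration and pushed forward. -/
lemma hasConditionalMarginals_iff :
    HasConditionalMarginals P Q π ↔ ∀ t : Fin T,
      π.map (fun z => (prPair t z, z.1)) =
        π.map (prPair t) ⊗ₘ (pathKernel P t).comap Prod.fst measurable_fst ∧
      π.map (fun z => (prPair t z, z.2)) =
        π.map (prPair t) ⊗ₘ (pathKernel Q t).comap Prod.snd measurable_snd := by
  refine forall_congr' fun t => and_congr ?_ ?_
  · rw [← forall_ae_condDistrib_preimage_eq_iff (measurable_prPair t) measurable_fst]
    simp only [prod_univ]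
    rfl
  · rw [← forall_ae_condDistrib_preimage_eq_iff (measurable_prPair t) measurable_snd]
    simp only [univ_prod]
    rfl

/-- If `η` disintegrates the law of `f` given the pair of initial histories at every stage, then
the law of `f` is `P`. -/
lemma map_eq_of_disintegration {f : Hist Ξ T × Hist Ξ T → Hist Ξ T} (hf : Measurable f)
    (g : (t : Fin T) → Hist Ξ t × Hist Ξ t → Hist Ξ t) (hg : ∀ t, Measurable (g t))
    (h : ∀ t : Fin T, π.map (fun z => (prPair t z, f z)) =
      π.map (prPair t) ⊗ₘ (pathKernel P t).comap (g t) (hg t)) :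
    π.map f = P := by
  rcases T with - | T
  · have hP (μ : Measure (Hist Ξ 0)) [IsProbabilityMeasure μ] :
        μ = Measure.dirac (emptyHist Ξ) := by
      have := Measure.map_const μ (emptyHist Ξ)
      rw [measure_univ, one_smul] at this
      rw [← this]
      exact Measure.map_id.symm.trans (congrArg μ.map (Subsingleton.elim _ _))
    have : IsProbabilityMeasure (π.map f) := Measure.isProbabilityMeasure_map hf.aemeasurable
    rw [hP P, hP (π.map f)]
  · have hsub : Subsingleton (Hist Ξ ((0 : Fin (T + 1)) : ℕ)) :=
      inferInstanceAs (Subsingleton (Hist Ξ 0))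
    have h₁ := map_eq_of_subsingleton (measurable_prPair 0) (h 0) (emptyHist Ξ, emptyHist Ξ)
    have h₂ := map_eq_of_subsingleton (measurable_pr 0)
      (compProd_map_condDistrib (μ := P) (X := pr (0 : Fin (T + 1)))
        (aemeasurable_id (μ := P))).symm (emptyHist Ξ)
    rw [Measure.map_id] at h₂
    rw [h₁, Kernel.comap_apply, Subsingleton.elim (g 0 _) (emptyHist Ξ)]
    exact h₂.symm

/-- The conditional law of the next state, given the pair of histories, is the one under `P`. -/
lemma map_stageKernel_of_disintegration {f : Hist Ξ T × Hist Ξ T → Hist Ξ T} (hf : Measurable f)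
    {t : Fin T} {g : Hist Ξ t × Hist Ξ t → Hist Ξ t} (hg : Measurable g)
    (hfg : ∀ z, g (prPair t z) = pr t (f z)) (hmap : π.map f = P)
    (h : π.map (fun z => (prPair t z, f z)) =
      π.map (prPair t) ⊗ₘ (pathKernel P t).comap g hg) :
    π.map (fun z => (prPair t z, f z t)) =
      π.map (prPair t) ⊗ₘ (stageKernel P t).comap g hg := by
  have heval : Measurable fun x : Hist Ξ T => x t := measurable_pi_apply t
  have hstage : stageKernel P t =ᵐ[P.map (pr t)] (pathKernel P t).map fun x => x t :=
    condDistrib_comp (pr t) aemeasurable_id heval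
  -- The stage and path kernels are related only up to `P`-null sets of histories; since `π` has
  -- marginal `P` along `f`, these pull back to `π`-null sets.
  have hlaw : (π.map (prPair t)).map g = P.map (pr t) := by
    rw [Measure.map_map hg (measurable_prPair t), ← hmap, Measure.map_map (measurable_pr t) hf]
    exact congrArg π.map (funext hfg)
  have hae : (stageKernel P t).comap g hg =ᵐ[π.map (prPair t)]
      ((pathKernel P t).comap g hg).map fun x => x t := by
    rw [← hlaw] at hstage
    filter_upwards [ae_of_ae_map hg.aemeasurable hstage] with z hz
    rw [Kernel.comap_apply, hz, Kernel.map_apply _ heval, Kernel.map_apply _ heval,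
      Kernel.comap_apply]
  rw [Measure.compProd_congr hae, Measure.compProd_map heval, ← h,
    Measure.map_map (by fun_prop) (by fun_prop)]
  rfl

/-- The kernel by which the bivariate measure `π` evolves at stage `t`. -/
noncomputable def jointStageKernel (π : Measure (Hist Ξ T × Hist Ξ T)) [IsFiniteMeasure π]
    (t : Fin T) : Kernel (Hist Ξ t × Hist Ξ t) (Ξ t × Ξ t) :=
  condDistrib (fun z => (z.1 t, z.2 t)) (prPair t) π

instance (t : Fin T) : IsMarkovKernel (jointStageKernel π t) := by
  unfold jointStageKernel; infer_instance

lemma map_compProd_jointStageKernel (t : Fin T) :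
    π.map (prPair t) ⊗ₘ jointStageKernel π t =
      π.map fun z => (prPair t z, (z.1 t, z.2 t)) :=
  compProd_map_condDistrib (by fun_prop)

/-- Projecting the joint disintegration to one path gives the same joint law as the stage kernel,
and disintegrations are almost surely unique. The constraint at time `0` first provides the
marginals `P` and `Q`. -/
lemma HasConditionalMarginals.ae_isCoupling (h : HasConditionalMarginals P Q π) (t : Fin T) :
    ∀ᵐ z ∂π.map (prPair t),
      IsCoupling (stageKernel P t z.1) (stageKernel Q t z.2) (jointStageKernel π t z) := by
  rw [hasConditionalMarginals_iff] at h
  have hP := map_stageKernel_of_disintegration measurable_fst measurable_fst (fun _ => rfl)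
    (map_eq_of_disintegration measurable_fst _ (fun _ => measurable_fst) fun t => (h t).1) (h t).1
  have hQ := map_stageKernel_of_disintegration measurable_snd measurable_snd (fun _ => rfl)
    (map_eq_of_disintegration measurable_snd _ (fun _ => measurable_snd) fun t => (h t).2) (h t).2
  have h₁ : (jointStageKernel π t).map Prod.fst =ᵐ[π.map (prPair t)]
      ((stageKernel P t).comap Prod.fst measurable_fst :
        Kernel (Hist Ξ t × Hist Ξ t) (Ξ t)) := by
    refine Kernel.ae_eq_of_compProd_eq ?_
    rw [← hP, Measure.compProd_map measurable_fst, map_compProd_jointStageKernel,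
      Measure.map_map (by fun_prop) (by fun_prop)]
    rfl
  have h₂ : (jointStageKernel π t).map Prod.snd =ᵐ[π.map (prPair t)]
      ((stageKernel Q t).comap Prod.snd measurable_snd :
        Kernel (Hist Ξ t × Hist Ξ t) (Ξ t)) := by
    refine Kernel.ae_eq_of_compProd_eq ?_
    rw [← hQ, Measure.compProd_map measurable_snd, map_compProd_jointStageKernel,
      Measure.map_map (by fun_prop) (by fun_prop)]
    rfl
  filter_upwards [h₁, h₂] with z hz₁ hz₂
  exact ⟨(Kernel.map_apply _ measurable_fst z).symm.trans hz₁,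
    (Kernel.map_apply _ measurable_snd z).symm.trans hz₂⟩

lemma wasserstein_rpow_le {X Y : Type u} [MeasurableSpace X] [MeasurableSpace Y] {r : ℝ}
    (hr : 0 < r) {μ : Measure X} {ν : Measure Y} {c : X → Y → ℝ≥0∞} {ρ : Measure (X × Y)}
    (hρ : IsCoupling μ ν ρ) : wasserstein r μ ν c ^ r ≤ ∫⁻ z, c z.1 z.2 ^ r ∂ρ := by
  refine (ENNReal.rpow_le_rpow (iInf₂_le ρ hρ) hr.le).trans_eq ?_
  rw [transportCost, ← ENNReal.rpow_mul, one_div_mul_cancel hr.ne', ENNReal.rpow_one]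

/-- Under the conditional marginal constraints, the nested distance is a lower bound of the
transport cost. -/
theorem HasConditionalMarginals.costProcess_zero_le {r : ℝ} (hr : 0 < r)
    {c : Hist Ξ T → Hist Ξ T → ℝ≥0∞}
    (hc : RectSemicontinuous fun z : Hist Ξ T × Hist Ξ T => c z.1 z.2)
    (h : HasConditionalMarginals P Q π) :
    costProcess r P Q c 0 (emptyHist Ξ) (emptyHist Ξ) ≤ transportCost r c π := by
  have hmeas (t : Fin (T + 1)) : Measurable fun z : Hist Ξ t × Hist Ξ t =>
      costProcess r P Q c t z.1 z.2 ^ r := (hc.costProcess hr t).measurable.pow_const r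
  have key (t : Fin (T + 1)) :
      costProcess r P Q c 0 (emptyHist Ξ) (emptyHist Ξ) ^ r ≤
        ∫⁻ z, costProcess r P Q c t (trunc t.is_le z.1) (trunc t.is_le z.2) ^ r ∂π := by
    induction t using Fin.induction with
    | zero =>
      have (x : Hist Ξ T) : trunc (Fin.is_le (0 : Fin (T + 1))) x = emptyHist Ξ :=
        Subsingleton.elim (α := Hist Ξ 0) _ _
      simp_rw [this]
      rw [lintegral_const, measure_univ, mul_one]
    | succ t ih =>
      have hm : Measurable fun z : Hist Ξ t × Hist Ξ t =>
        costProcess r P Q c t.castSucc z.1 z.2 ^ r := hmeas t.castSucc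
      have hm' : Measurable fun q : (Hist Ξ t × Hist Ξ t) × (Ξ t × Ξ t) =>
        costProcess r P Q c t.succ (extend q.1.1 q.2.1) (extend q.1.2 q.2.2) ^ r :=
        (hmeas t.succ).comp measurable_extend_pair
      refine ih.trans ?_
      calc
        _ = ∫⁻ z, costProcess r P Q c t.castSucc z.1 z.2 ^ r ∂π.map (prPair t) :=
          (lintegral_map hm (measurable_prPair t)).symm
        _ ≤ ∫⁻ z, ∫⁻ w, costProcess r P Q c t.succ (extend z.1 w.1) (extend z.2 w.2) ^ r
              ∂jointStageKernel π t z ∂π.map (prPair t) := by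
          -- At almost every pair of histories the kernel of `π` is a competitor for `c_t`.
          refine lintegral_mono_ae <| (h.ae_isCoupling t).mono fun z hz => ?_
          rw [costProcess_castSucc]
          exact wasserstein_rpow_le hr hz
        _ = ∫⁻ q, costProcess r P Q c t.succ (extend q.1.1 q.2.1) (extend q.1.2 q.2.2) ^ r
              ∂(π.map fun z => (prPair t z, (z.1 t, z.2 t))) := by
          rw [← map_compProd_jointStageKernel, Measure.lintegral_compProd hm']
        _ = _ := by
          rw [lintegral_map hm' (by fun_prop)]
          refine lintegral_congr fun z => ?_
          have (x : Hist Ξ T) : extend (pr t x) (x t) = trunc t.succ.is_le x :=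
            extend_trunc t.isLt x
          simp only [prPair, this]
  have hlast := key (Fin.last T)
  rw [costProcess_last] at hlast
  rw [transportCost, one_div, ENNReal.le_rpow_inv_iff hr]
  exact hlast

end ConditionalMarginals

/-! ### The glued measure satisfies the constraints -/

section Glue

variable {Ξ : ℕ → Type u} {T : ℕ} [∀ i, MeasurableSpace (Ξ i)]
  {κ : (t : Fin T) → Kernel (Hist Ξ t × Hist Ξ t) (Ξ t × Ξ t)}

lemma glueUpTo_succ (t : Fin T) : glueUpTo κ t.succ =
    Measure.map (fun q : (Hist Ξ t × Hist Ξ t) × (Ξ t × Ξ t) =>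
      ((extend q.1.1 q.2.1, extend q.1.2 q.2.2) : Hist Ξ (t + 1) × Hist Ξ (t + 1)))
      (Measure.compProd (glueUpTo κ t.castSucc) (κ t)) := rfl

variable [∀ t, IsMarkovKernel (κ t)]

instance isProbabilityMeasure_glueUpTo (t : Fin (T + 1)) :
    IsProbabilityMeasure (glueUpTo κ t) := by
  induction t using Fin.induction with
  | zero => exact Measure.dirac.isProbabilityMeasure (x := (emptyHist Ξ, emptyHist Ξ))
  | succ t ih =>
    rw [glueUpTo_succ]
    have : IsProbabilityMeasure (Measure.compProd (glueUpTo κ t.castSucc) (κ t)) :=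
      inferInstance
    exact Measure.isProbabilityMeasure_map measurable_extend_pair.aemeasurable

/-- The law of the initial histories before stage `t` under the glued measure. -/
noncomputable def glueBefore (κ : (t : Fin T) → Kernel (Hist Ξ t × Hist Ξ t) (Ξ t × Ξ t))
    (t : Fin T) : Measure (Hist Ξ t × Hist Ξ t) :=
  glueUpTo κ t.castSucc

instance isProbabilityMeasure_glueBefore (t : Fin T) : IsProbabilityMeasure (glueBefore κ t) :=
  isProbabilityMeasure_glueUpTo t.castSucc

lemma lintegral_glueUpTo_succ (t : Fin T) {f : Hist Ξ (t + 1) × Hist Ξ (t + 1) → ℝ≥0∞}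
    (hf : Measurable f) :
    ∫⁻ z, f z ∂glueUpTo κ t.succ =
      ∫⁻ z, ∫⁻ w, f (extend z.1 w.1, extend z.2 w.2) ∂κ t z ∂glueBefore κ t :=
  (lintegral_map hf measurable_extend_pair).trans
    (Measure.lintegral_compProd (μ := glueBefore κ t) (hf.comp measurable_extend_pair))

/-- The kernels with the roles of the two paths exchanged. -/
noncomputable def swapKernels (κ : (t : Fin T) → Kernel (Hist Ξ t × Hist Ξ t) (Ξ t × Ξ t))
    (t : Fin T) : Kernel (Hist Ξ t × Hist Ξ t) (Ξ t × Ξ t) :=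
  ((κ t).comap Prod.swap measurable_swap).map Prod.swap

instance (t : Fin T) : IsMarkovKernel (swapKernels κ t) :=
  Kernel.IsMarkovKernel.map _ measurable_swap

/-- This symmetry lets every statement about the second path be deduced from the one about the
first. -/
lemma glueUpTo_swapKernels (t : Fin (T + 1)) :
    glueUpTo (swapKernels κ) t = (glueUpTo κ t).map Prod.swap := by
  induction t using Fin.induction with
  | zero =>
    have h : (Measure.dirac (emptyHist Ξ, emptyHist Ξ) : Measure (Hist Ξ 0 × Hist Ξ 0)).map
        Prod.swap = Measure.dirac (emptyHist Ξ, emptyHist Ξ) := Measure.map_dirac' measurable_swap _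
    exact h.symm
  | succ t ih =>
    refine Measure.ext_of_lintegral _ fun f hf => ?_
    have hm : Measurable fun q : (Hist Ξ t × Hist Ξ t) × (Ξ t × Ξ t) =>
      f (extend q.1.1 q.2.1, extend q.1.2 q.2.2) := hf.comp measurable_extend_pair
    have hbefore : glueBefore (swapKernels κ) t = (glueBefore κ t).map Prod.swap := ih
    calc
      _ = ∫⁻ z, ∫⁻ w, f (extend z.1 w.1, extend z.2 w.2) ∂swapKernels κ t z
            ∂glueBefore (swapKernels κ) t := lintegral_glueUpTo_succ t hf
      _ = ∫⁻ z, ∫⁻ w, f (extend z.2 w.1, extend z.1 w.2) ∂swapKernels κ t z.swap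
            ∂glueBefore κ t := by
        rw [hbefore]
        exact lintegral_map hm.lintegral_kernel_prod_right' measurable_swap
      _ = ∫⁻ z, ∫⁻ w, f (extend z.2 w.2, extend z.1 w.1) ∂κ t z ∂glueBefore κ t := by
        refine lintegral_congr fun z => ?_
        rw [swapKernels, Kernel.map_apply _ measurable_swap, Kernel.comap_apply, Prod.swap_swap]
        exact lintegral_map (hm.comp (measurable_prodMk_left (x := (z.2, z.1)))) measurable_swap
      _ = ∫⁻ z, f z.swap ∂glueUpTo κ t.succ :=
        (lintegral_glueUpTo_succ t (f := fun z => f z.swap) (hf.comp measurable_swap)).symm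
      _ = _ := (lintegral_map hf measurable_swap).symm

variable [∀ i, StandardBorelSpace (Ξ i)] [∀ i, Nonempty (Ξ i)]
  {P Q : Measure (Hist Ξ T)} [IsProbabilityMeasure P] [IsProbabilityMeasure Q]

lemma lintegral_map_trunc_succ (t : Fin T) {f : Hist Ξ (t + 1) → ℝ≥0∞} (hf : Measurable f) :
    ∫⁻ x, f x ∂P.map (trunc t.succ.is_le) =
      ∫⁻ x : Hist Ξ t, ∫⁻ u, f (extend x u) ∂stageKernel P t x ∂P.map (pr t) := by
  have hm : Measurable fun p : Hist Ξ t × Ξ t => f (extend p.1 p.2) := hf.comp measurable_extend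
  rw [← Measure.lintegral_compProd hm, stageKernel,
    compProd_map_condDistrib (measurable_pi_apply t).aemeasurable,
    lintegral_map hm (by fun_prop)]
  refine (lintegral_map (μ := P) hf (measurable_trunc t.succ.is_le)).trans
    (lintegral_congr fun x => ?_)
  exact congrArg f (extend_trunc t.isLt x).symm

/-- If `η` disintegrates the glued measure at stage `t`, then it remains the conditional law of
the second initial history given the first path at all later stages. -/
lemma lintegral_glueUpTo_eq_of_disintegration
    (hκ : ∀ (t : Fin T) (z : Hist Ξ t × Hist Ξ t), (κ t z).map Prod.fst = stageKernel P t z.1)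
    (t : Fin (T + 1)) (η : Kernel (Hist Ξ t) (Hist Ξ t)) [IsMarkovKernel η]
    (hη : ∀ f : Hist Ξ t × Hist Ξ t → ℝ≥0∞, Measurable f →
      ∫⁻ z, f z ∂glueUpTo κ t = ∫⁻ x, ∫⁻ y, f (x, y) ∂η x ∂P.map (trunc t.is_le))
    (s : Fin (T + 1)) (h : (t : ℕ) ≤ s) {f : Hist Ξ s × Hist Ξ t → ℝ≥0∞} (hf : Measurable f) :
    ∫⁻ z, f (z.1, trunc h z.2) ∂glueUpTo κ s =
      ∫⁻ x, ∫⁻ y, f (x, y) ∂η (trunc h x) ∂P.map (trunc s.is_le) := by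
  induction s using Fin.induction with
  | zero =>
    obtain rfl : t = 0 := Fin.ext (Nat.le_zero.1 h)
    exact hη f hf
  | succ s ih =>
    rcases h.eq_or_lt with heq | hlt
    · obtain rfl : t = s.succ := Fin.ext heq
      exact hη f hf
    have hts : (t : ℕ) ≤ s := Nat.lt_succ_iff.1 hlt
    have hstep : Measurable fun p : (Hist Ξ s × Hist Ξ t) × Ξ s =>
        f (extend p.1.1 p.2, p.1.2) :=
      hf.comp ((Measurable.extend (by fun_prop) (by fun_prop)).prodMk (by fun_prop))
    have hg : Measurable fun p : Hist Ξ s × Hist Ξ t =>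
        ∫⁻ u, f (extend p.1 u, p.2) ∂stageKernel P s p.1 :=
      hstep.lintegral_kernel_prod_right'
        (κ := (stageKernel P s).comap (Prod.fst : Hist Ξ s × Hist Ξ t → Hist Ξ s) measurable_fst)
    calc
      _ = ∫⁻ z, ∫⁻ w, f (extend z.1 w.1, trunc h (extend z.2 w.2)) ∂κ s z ∂glueBefore κ s :=
        lintegral_glueUpTo_succ s (f := fun z => f (z.1, trunc h z.2))
          (hf.comp (measurable_fst.prodMk ((measurable_trunc h).comp measurable_snd)))
      _ = ∫⁻ z, ∫⁻ u, f (extend z.1 u, trunc hts z.2) ∂stageKernel P s z.1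
            ∂glueBefore κ s := by
        -- The new state of the second path is truncated away, so only the first marginal of `κ s z`
        -- enters.
        refine lintegral_congr fun z => ?_
        rw [← hκ, lintegral_map (f := fun u => f (extend z.1 u, trunc hts z.2))
          (hstep.comp (measurable_prodMk_left (x := (z.1, trunc hts z.2)))) measurable_fst]
        exact lintegral_congr fun w => by rw [← trunc_extend hts z.2 w.2]
      _ = ∫⁻ x : Hist Ξ s, ∫⁻ y, ∫⁻ u, f (extend x u, y) ∂stageKernel P s x ∂η (trunc hts x)
            ∂P.map (pr s) := ih hts hg
      _ = ∫⁻ x : Hist Ξ s, ∫⁻ u, ∫⁻ y, f (extend x u, y) ∂η (trunc h (extend x u))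
            ∂stageKernel P s x ∂P.map (pr s) := by
        refine lintegral_congr fun x => ?_
        -- The truncation to `t ≤ s` ignores the new state, so `η` does not depend on `u` and
        -- Tonelli applies.
        simp_rw [trunc_extend hts]
        exact lintegral_lintegral_swap (hf.comp (by fun_prop)).aemeasurable
      _ = _ := by
        refine (lintegral_map_trunc_succ s (f := fun x => ∫⁻ y, f (x, y) ∂η (trunc h x)) ?_).symm
        exact hf.lintegral_kernel_prod_right' (κ := η.comap (trunc h) (measurable_trunc h))

/-- Start the previous lemma at `t = 0`, where the second history is empty and the identity kernel
disintegrates trivially. -/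
lemma map_fst_glueUpTo
    (hκ : ∀ (t : Fin T) (z : Hist Ξ t × Hist Ξ t), (κ t z).map Prod.fst = stageKernel P t z.1)
    (t : Fin (T + 1)) : (glueUpTo κ t).map Prod.fst = P.map (trunc t.is_le) := by
  refine Measure.ext_of_lintegral _ fun f hf => ?_
  have hbase (g : Hist Ξ 0 × Hist Ξ 0 → ℝ≥0∞) (hg : Measurable g) :
      ∫⁻ z, g z ∂glueUpTo κ 0 = ∫⁻ x, ∫⁻ y, g (x, y) ∂(Kernel.id : Kernel (Hist Ξ 0) (Hist Ξ 0)) x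
        ∂P.map (trunc (Nat.zero_le T)) := by
    have hdiag : Measurable fun x : Hist Ξ 0 => g (x, x) := by fun_prop
    have hid (x : Hist Ξ 0) :
        ∫⁻ y, g (x, y) ∂(Kernel.id : Kernel (Hist Ξ 0) (Hist Ξ 0)) x = g (x, x) :=
      lintegral_dirac' x (hg.comp measurable_prodMk_left)
    refine (lintegral_dirac' _ hg).trans ?_
    simp_rw [hid]
    rw [lintegral_map hdiag (measurable_trunc _)]
    have (x : Hist Ξ T) : g (trunc (Nat.zero_le T) x, trunc (Nat.zero_le T) x) =
        g (emptyHist Ξ, emptyHist Ξ) := congrArg g (Subsingleton.elim _ _)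
    simp_rw [this, lintegral_const, measure_univ, mul_one]
    rfl
  have := lintegral_glueUpTo_eq_of_disintegration hκ 0 Kernel.id hbase t (Nat.zero_le t)
    (f := fun z => f z.1) (hf.comp measurable_fst)
  rw [lintegral_map hf measurable_fst, this]
  exact lintegral_congr fun x =>
    lintegral_dirac' (f := fun _ => f x) (trunc (Nat.zero_le t) x) measurable_const

/-- Under the glued measure, the conditional law of the first path given both initial histories is
its conditional law under `P` given the first initial history. -/
lemma lintegral_glue_prPair
    (hκ : ∀ (t : Fin T) (z : Hist Ξ t × Hist Ξ t), (κ t z).map Prod.fst = stageKernel P t z.1)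
    (t : Fin T) {f : (Hist Ξ t × Hist Ξ t) × Hist Ξ T → ℝ≥0∞} (hf : Measurable f) :
    ∫⁻ z, f (prPair t z, z.1) ∂glue κ =
      ∫⁻ z, ∫⁻ x, f (z, x) ∂pathKernel P t z.1 ∂glueBefore κ t := by
  have hlaw : (glueBefore κ t).map Prod.fst = P.map (pr t) := map_fst_glueUpTo hκ t.castSucc
  -- The law of `y_{1:t}` given `x_{1:t}`. By causality it is also the law of `y_{1:t}` given the
  -- whole path `x`; the Tonelli exchange below then turns this conditional independence into the
  -- law of `x` given both histories.
  let η : Kernel (Hist Ξ t) (Hist Ξ t) := condDistrib Prod.snd Prod.fst (glueBefore κ t)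
  have hη (g : Hist Ξ t × Hist Ξ t → ℝ≥0∞) (hg : Measurable g) :
      ∫⁻ z, g z ∂glueBefore κ t = ∫⁻ x, ∫⁻ y, g (x, y) ∂η x ∂P.map (pr t) := by
    rw [← hlaw, ← Measure.lintegral_compProd hg,
      compProd_map_condDistrib measurable_snd.aemeasurable]
    exact congrArg (fun μ => ∫⁻ z, g z ∂μ) Measure.map_id.symm
  have hg : Measurable fun p : Hist Ξ T × Hist Ξ t => f ((pr t p.1, p.2), p.1) := by
    fun_prop
  have hg' : Measurable fun p : Hist Ξ t × Hist Ξ T =>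
      ∫⁻ y, f ((p.1, y), p.2) ∂η p.1 :=
    Measurable.lintegral_kernel_prod_right'
      (f := fun q : (Hist Ξ t × Hist Ξ T) × Hist Ξ t => f ((q.1.1, q.2), q.1.2))
      (by fun_prop)
      (κ := η.comap (Prod.fst : Hist Ξ t × Hist Ξ T → Hist Ξ t) measurable_fst)
  have hpath : P.map (pr t) ⊗ₘ pathKernel P t = P.map fun x => (pr t x, x) :=
    compProd_map_condDistrib aemeasurable_id
  calc
    _ = ∫⁻ x, ∫⁻ y, f ((pr t x, y), x) ∂η (pr t x) ∂P := by
      refine (lintegral_glueUpTo_eq_of_disintegration hκ t.castSucc η hη (Fin.last T)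
        t.isLt.le hg).trans ?_
      exact congrArg (fun μ => ∫⁻ x, ∫⁻ y, f ((pr t x, y), x) ∂η (pr t x) ∂μ) Measure.map_id
    _ = ∫⁻ p, ∫⁻ y, f ((p.1, y), p.2) ∂η p.1 ∂(P.map fun x => (pr t x, x)) :=
      (lintegral_map hg' ((measurable_pr t).prodMk measurable_id)).symm
    _ = ∫⁻ x, ∫⁻ x', ∫⁻ y, f ((x, y), x') ∂η x ∂pathKernel P t x ∂P.map (pr t) := by
      rw [← hpath, Measure.lintegral_compProd hg']
    _ = ∫⁻ x, ∫⁻ y, ∫⁻ x', f ((x, y), x') ∂pathKernel P t x ∂η x ∂P.map (pr t) := by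
      refine lintegral_congr fun x => lintegral_lintegral_swap (Measurable.aemeasurable ?_)
      change Measurable fun p : Hist Ξ T × Hist Ξ t => f ((x, p.2), p.1)
      fun_prop
    _ = _ := by
      refine (hη (fun z => ∫⁻ x', f (z, x') ∂pathKernel P t z.1) ?_).symm
      exact hf.lintegral_kernel_prod_right'
        (κ := (pathKernel P t).comap (Prod.fst : Hist Ξ t × Hist Ξ t → Hist Ξ t) measurable_fst)

instance isProbabilityMeasure_glue : IsProbabilityMeasure (glue κ) :=
  isProbabilityMeasure_glueUpTo (Fin.last T)

lemma map_prPair_fst_glue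
    (hκ : ∀ (t : Fin T) (z : Hist Ξ t × Hist Ξ t), (κ t z).map Prod.fst = stageKernel P t z.1)
    (t : Fin T) : (glue κ).map (fun z => (prPair t z, z.1)) =
      (glue κ).map (prPair t) ⊗ₘ (pathKernel P t).comap Prod.fst measurable_fst := by
  have hmap : (glue κ).map (prPair t) = glueBefore κ t := by
    refine Measure.ext_of_lintegral _ fun f hf => ?_
    rw [lintegral_map hf (measurable_prPair t),
      lintegral_glue_prPair hκ t (f := fun p => f p.1) (hf.comp measurable_fst)]
    simp
  refine Measure.ext_of_lintegral _ fun f hf => ?_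
  rw [lintegral_map hf (by fun_prop), lintegral_glue_prPair hκ t hf, hmap,
    Measure.lintegral_compProd hf]
  rfl

/-- The half for `Q` is the half for the first path applied to the exchanged kernels, whose first
marginals are the stage kernels of `Q`. -/
theorem hasConditionalMarginals_glue
    (hκ : ∀ (t : Fin T) (x y : Hist Ξ t),
      IsCoupling (stageKernel P t x) (stageKernel Q t y) (κ t (x, y))) :
    HasConditionalMarginals P Q (glue κ) := by
  refine hasConditionalMarginals_iff.2 fun t =>
    ⟨map_prPair_fst_glue (fun t z => (hκ t z.1 z.2).1) t, ?_⟩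
  have hswap (t : Fin T) (z : Hist Ξ t × Hist Ξ t) :
      (swapKernels κ t z).map Prod.fst = stageKernel Q t z.1 := by
    rw [swapKernels, Kernel.map_apply _ measurable_swap,
      Measure.map_map measurable_fst measurable_swap]
    exact (hκ t z.2 z.1).2
  have h := map_prPair_fst_glue hswap t
  have hglue : glue (swapKernels κ) = (glue κ).map Prod.swap := glueUpTo_swapKernels (Fin.last T)
  refine Measure.ext_of_lintegral _ fun f hf => ?_
  have hf' : Measurable fun p : (Hist Ξ t × Hist Ξ t) × Hist Ξ T => f (p.1.swap, p.2) :=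
    hf.comp (by fun_prop)
  have h₁ : ∫⁻ p, f (p.1.swap, p.2) ∂((glue (swapKernels κ)).map fun z => (prPair t z, z.1)) =
      ∫⁻ p, f (p.1.swap, p.2) ∂((glue (swapKernels κ)).map (prPair t) ⊗ₘ
        (pathKernel Q t).comap Prod.fst measurable_fst) := by rw [h]
  rw [Measure.lintegral_compProd hf', lintegral_map hf' (by fun_prop),
    lintegral_map hf'.lintegral_kernel_prod_right' (by fun_prop), hglue] at h₁
  have hm₁ : Measurable fun z : Hist Ξ T × Hist Ξ T => f ((prPair t z).swap, z.1) := by fun_prop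
  have hm₂ : Measurable fun z : Hist Ξ T × Hist Ξ T =>
      ∫⁻ y, f ((prPair t z).swap, y) ∂pathKernel Q t (prPair t z).1 :=
    (hf'.lintegral_kernel_prod_right' (κ := (pathKernel Q t).comap
      (Prod.fst : Hist Ξ t × Hist Ξ t → Hist Ξ t) measurable_fst)).comp (measurable_prPair t)
  rw [Measure.lintegral_compProd hf, lintegral_map hf (by fun_prop),
    lintegral_map hf.lintegral_kernel_prod_right' (by fun_prop)]
  exact (lintegral_map hm₁ measurable_swap).symm.trans
    (h₁.trans (lintegral_map hm₂ measurable_swap))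

end Glue

/-! ### Attainment by optimal kernels -/

section Optimal

variable {Ξ : ℕ → Type u} {T : ℕ} [∀ i, MeasurableSpace (Ξ i)]
  {κ : (t : Fin T) → Kernel (Hist Ξ t × Hist Ξ t) (Ξ t × Ξ t)}
  [∀ i, StandardBorelSpace (Ξ i)] [∀ i, Nonempty (Ξ i)] {r : ℝ}
  {P Q : Measure (Hist Ξ T)} [IsProbabilityMeasure P] [IsProbabilityMeasure Q]
  {c : Hist Ξ T → Hist Ξ T → ℝ≥0∞}

lemma AreOptimalKernels.isMarkovKernel (hκ : AreOptimalKernels r P Q c κ) (t : Fin T) :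
    IsMarkovKernel (κ t) :=
  ⟨fun z => (hκ t z.1 z.2).1.isProbabilityMeasure⟩

/-- The glued optimal measure attains the nested distance. -/
theorem AreOptimalKernels.transportCost_glue (hr : 0 < r)
    (hc : RectSemicontinuous fun z : Hist Ξ T × Hist Ξ T => c z.1 z.2)
    (hκ : AreOptimalKernels r P Q c κ) :
    transportCost r c (glue κ) = costProcess r P Q c 0 (emptyHist Ξ) (emptyHist Ξ) := by
  have := hκ.isMarkovKernel
  have hmeas (t : Fin (T + 1)) : Measurable fun z : Hist Ξ t × Hist Ξ t =>
      costProcess r P Q c t z.1 z.2 ^ r := (hc.costProcess hr t).measurable.pow_const r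
  have key (t : Fin (T + 1)) :
      ∫⁻ z, costProcess r P Q c t z.1 z.2 ^ r ∂glueUpTo κ t =
        costProcess r P Q c 0 (emptyHist Ξ) (emptyHist Ξ) ^ r := by
    induction t using Fin.induction with
    | zero => exact lintegral_dirac' _ (hmeas 0)
    | succ t ih =>
      rw [← ih]
      refine (lintegral_glueUpTo_succ t (hmeas t.succ)).trans
        (lintegral_congr (μ := glueBefore κ t) fun z => ?_)
      -- Optimality at every history turns the inequality of the lower bound into an equality.
      refine Eq.trans ?_ (congrArg (· ^ r) (((hκ t z.1 z.2).2.trans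
        (costProcess_castSucc t z.1 z.2).symm)))
      simp only [transportCost]
      rw [← ENNReal.rpow_mul, one_div_mul_cancel hr.ne', ENNReal.rpow_one]
  have hlast := key (Fin.last T)
  rw [costProcess_last] at hlast
  have h : ∫⁻ z, c z.1 z.2 ^ r ∂glue κ = _ := hlast
  rw [transportCost, h, ← ENNReal.rpow_mul, mul_one_div_cancel hr.ne', ENNReal.rpow_one]

end Optimal

end NestedDistance

/-! ### The main theorem -/

theorem mainTheorem5 {T : ℕ} {Ξ : ℕ → Type u}
    [∀ i, TopologicalSpace (Ξ i)] [∀ i, PolishSpace (Ξ i)]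
    [∀ i, MeasurableSpace (Ξ i)] [∀ i, BorelSpace (Ξ i)] [∀ i, Nonempty (Ξ i)]
    (d : NestedDistance.Hist Ξ T → NestedDistance.Hist Ξ T → ℝ)
    (hd : NestedDistance.IsPolishMetric d)
    (P Q : Measure (NestedDistance.Hist Ξ T)) [IsProbabilityMeasure P] [IsProbabilityMeasure Q]
    (r : ℝ) (hr : 1 ≤ r) :
    NestedDistance.nestedDist r d P Q =
      (⨅ (π : ProbabilityMeasure (NestedDistance.Hist Ξ T × NestedDistance.Hist Ξ T))
        (_ : NestedDistance.HasConditionalMarginals P Q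
          (π : Measure (NestedDistance.Hist Ξ T × NestedDistance.Hist Ξ T))),
        NestedDistance.transportCost r (fun x y => ENNReal.ofReal (d x y))
          (π : Measure (NestedDistance.Hist Ξ T × NestedDistance.Hist Ξ T))) ∧
    (∃ κ : (t : Fin T) → Kernel (NestedDistance.Hist Ξ t × NestedDistance.Hist Ξ t) (Ξ t × Ξ t),
      NestedDistance.AreOptimalKernels r P Q (fun x y => ENNReal.ofReal (d x y)) κ) ∧
    (∀ κ : (t : Fin T) → Kernel (NestedDistance.Hist Ξ t × NestedDistance.Hist Ξ t) (Ξ t × Ξ t),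
      NestedDistance.AreOptimalKernels r P Q (fun x y => ENNReal.ofReal (d x y)) κ →
      ∃ π : ProbabilityMeasure (NestedDistance.Hist Ξ T × NestedDistance.Hist Ξ T),
        (π : Measure (NestedDistance.Hist Ξ T × NestedDistance.Hist Ξ T)) =
          NestedDistance.glue κ ∧
        NestedDistance.HasConditionalMarginals P Q
          (π : Measure (NestedDistance.Hist Ξ T × NestedDistance.Hist Ξ T)) ∧
        NestedDistance.transportCost r (fun x y => ENNReal.ofReal (d x y))
          (π : Measure (NestedDistance.Hist Ξ T × NestedDistance.Hist Ξ T)) =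
          NestedDistance.nestedDist r d P Q) := by
  have hr₀ : 0 < r := zero_lt_one.trans_le hr
  have hc := hd.rectSemicontinuous
  have hglue (κ : (t : Fin T) →
      Kernel (NestedDistance.Hist Ξ t × NestedDistance.Hist Ξ t) (Ξ t × Ξ t))
      (hκ : NestedDistance.AreOptimalKernels r P Q (fun x y => ENNReal.ofReal (d x y)) κ) :
      ∃ π : ProbabilityMeasure (NestedDistance.Hist Ξ T × NestedDistance.Hist Ξ T),
        (π : Measure (NestedDistance.Hist Ξ T × NestedDistance.Hist Ξ T)) =
          NestedDistance.glue κ ∧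
        NestedDistance.HasConditionalMarginals P Q
          (π : Measure (NestedDistance.Hist Ξ T × NestedDistance.Hist Ξ T)) ∧
        NestedDistance.transportCost r (fun x y => ENNReal.ofReal (d x y))
          (π : Measure (NestedDistance.Hist Ξ T × NestedDistance.Hist Ξ T)) =
          NestedDistance.nestedDist r d P Q := by
    have := hκ.isMarkovKernel
    exact ⟨⟨NestedDistance.glue κ, NestedDistance.isProbabilityMeasure_glue⟩, rfl,
      NestedDistance.hasConditionalMarginals_glue fun t x y => (hκ t x y).1,
      hκ.transportCost_glue hr₀ hc⟩
  obtain ⟨κ, hκ⟩ := NestedDistance.exists_areOptimalKernels (P := P) (Q := Q)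
    (c := fun x y => ENNReal.ofReal (d x y)) hr₀ hc
  refine ⟨le_antisymm (le_iInf₂ fun π hπ => hπ.costProcess_zero_le hr₀ hc) ?_, ⟨κ, hκ⟩, hglue⟩
  obtain ⟨π, -, hπ, hcost⟩ := hglue κ hκ
  exact (iInf₂_le π hπ).trans hcost.le
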